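/- **Setting.** A filtered space of formal dimension $n$ is a Hausdorff space $X$ with closed subspaces $X_0\subseteq X_1\subseteq\dots\subseteq X_n=X$ (we put $X_{-1}=\emptyset$; $X_{n-1}\neq X_n$ is not required). Its strata $S$ are the connected components of the subspaces $X_i\setminus X_{i-1}$, $0\le i\le n$, with $\operatorname{codim}S=n-i$; the strata with $i=n$ are regular, the others singular. The stratification is locally finite if every point has a neighbourhood that meets only finitely many strata. A perversity $\bar p$ assigns to each stratum an element of $\mathbb Z\cup\{\pm\infty\}$, with value $0$ on regular strata; $(X,\bar p)$ is then a perverse space. An open subset $U\subseteq X$ carries the filtration $U_i=U\cap X_i$ and the induced perversity $\bar p(S')=\bar p(S)$, where $S$ is the stratum of $X$ containing the stratum $S'$ of $U$. A subset $A$ of a Euclidean space has polyhedral dimension $\le d$ if it is contained in a union of finitely many Euclidean simplexes of dimension $\le d$ (so $\dim\emptyset=-\infty$). A singular simplex $\sigma\colon\Delta^k\to X$ is $\bar p$-allowable if $\dim\sigma^{-1}(S)\le k-\operatorname{codim}S+\bar p(S)$ for every singular stratum $S$, for the polyhedral dimension. Let $R$ be a Dedekind domain and $G$ an $R$-module. A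 singular chain with coefficients in $G$ is $\bar p$-allowable if it is a linear combination of $\bar p$-allowable simplexes; $C^{\bar p}_*(X;G)$ is the complex of the singular chains $\xi$ such that $\xi$ and $\partial\xi$ are $\bar p$-allowable, and $H^{\bar p}_*(X;G)$ is its homology. **Theorem.** Let $(X,\bar p)$ be a perverse space and let $\{U,V\}$ be an open cover of $X$ such that the induced stratifications of $U$, $V$ and $U\cap V$ (hence also that of $X$) are locally finite. Then there is a long exact sequence of $R$-modules $$\cdots\to H^{\bar p}_{k}(U\cap V;G)\to H^{\bar p}_{k}(U;G)\oplus H^{\bar p}_{k}(V;G)\to H^{\bar p}_{k}(X;G)\to H^{\bar p}_{k-1}(U\cap V;G)\to\cdots\to H^{\bar p}_{0}(X;G)\to 0,$$ in which the first map is $\alpha\mapsto(\alpha|_U,-\alpha|_V)$ and the second is $(\alpha,\beta)\mapsto\alpha|_X+\beta|_X$, where $\alpha|_U$ and so on are the images under the maps induced by the inclusions. -/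

import Mathlib

namespace PolyIH

open Topology TopologicalSpace

noncomputable section

universe u v w

/-! ### Polyhedra and polyhedral dimension -/

/-- The extended integers `ℤ ∪ {-∞, +∞}`. -/
abbrev ExtInt : Type := WithBot (WithTop ℤ)

/-- The integer `m` as an extended integer. -/
def ofInt (m : ℤ) : ExtInt := ((m : WithTop ℤ) : ExtInt)

/-- `s` is the vertex set of a (nonempty) Euclidean simplex, the convex hull of `s`;
its dimension is `s.card - 1`. -/
def IsSimplexVertices {E : Type*} [AddCommGroup E] [Module ℝ E] (s : Finset E) : Prop :=
  s.Nonempty ∧ AffineIndependent ℝ (Subtype.val : {x // x ∈ s} → E)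

/-- `Q` is a polyhedron of dimension at most `d`: a union of finitely many Euclidean simplexes,
all of dimension at most `d`. The empty set is the empty union, so it has dimension at
most `-∞`, while a nonempty polyhedron has dimension at least `0`. -/
def IsPolyhedronOfDimLE {E : Type*} [AddCommGroup E] [Module ℝ E] (Q : Set E) (d : ExtInt) :
    Prop :=
  ∃ T : Finset (Finset E),
    (∀ s ∈ T, IsSimplexVertices s ∧ ofInt ((s.card : ℤ) - 1) ≤ d) ∧
    Q = ⋃ s ∈ T, convexHull ℝ (s : Set E)

/-- `A` is of polyhedral dimension at most `d`: it is included in a polyhedron of dimension at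
most `d`. -/
def PolyDimLE {E : Type*} [AddCommGroup E] [Module ℝ E] (A : Set E) (d : ExtInt) : Prop :=
  ∃ Q : Set E, IsPolyhedronOfDimLE Q d ∧ A ⊆ Q

theorem PolyDimLE.mono {E : Type*} [AddCommGroup E] [Module ℝ E] {A B : Set E} {d : ExtInt}
    (h : PolyDimLE B d) (hAB : A ⊆ B) : PolyDimLE A d := by
  obtain ⟨Q, hQ, hB⟩ := h
  exact ⟨Q, hQ, hAB.trans hB⟩

theorem PolyDimLE.biUnion {E : Type*} [AddCommGroup E] [Module ℝ E] {ι : Type*} {I : Set ι}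
    (hI : I.Finite) {A : ι → Set E} {d : ExtInt} (h : ∀ i ∈ I, PolyDimLE (A i) d) :
    PolyDimLE (⋃ i ∈ I, A i) d := by
  classical
  induction I, hI using Set.Finite.induction_on with
  | empty => exact ⟨∅, ⟨∅, by simp, by simp⟩, by simp⟩
  | @insert a s _ _ ih =>
    obtain ⟨Q₁, ⟨T₁, hT₁, rfl⟩, hA₁⟩ := h a (Set.mem_insert _ _)
    obtain ⟨Q₂, ⟨T₂, hT₂, rfl⟩, hA₂⟩ := ih fun i hi => h i (Set.mem_insert_of_mem _ hi)
    refine ⟨_, ⟨T₁ ∪ T₂, ?_, rfl⟩, ?_⟩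
    · intro t ht
      rcases Finset.mem_union.1 ht with ht | ht
      · exact hT₁ t ht
      · exact hT₂ t ht
    · rw [Set.biUnion_insert, Finset.set_biUnion_union]
      exact Set.union_subset_union hA₁ hA₂

/-! ### Filtered spaces, strata, perversities -/

/-- A filtration `X₀ ⊆ X₁ ⊆ ⋯ ⊆ X_n = X` of `X` by closed subspaces, of formal dimension `n`.
The condition `X_{n-1} ≠ X_n` is not part of the structure, so that every open subset of a
filtered space (also an empty one) is filtered by the induced filtration. -/
structure Filtration (X : Type u) [TopologicalSpace X] (n : ℕ) where
  level : Fin (n + 1) → Set X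
  isClosed_level : ∀ i, IsClosed (level i)
  mono : Monotone level
  level_last : level (Fin.last n) = Set.univ

variable {X : Type u} [TopologicalSpace X] {Y : Type u} [TopologicalSpace Y]
  {Z : Type u} [TopologicalSpace Z] {n : ℕ}

/-- `X_i \ X_{i-1}` (with `X_{-1} = ∅`). -/
def Filtration.pure (F : Filtration X n) (i : Fin (n + 1)) : Set X :=
  F.level i \ ⋃ j < i, F.level j

/-- The (nonempty) strata: the connected components of the subspaces `X_i \ X_{i-1}`. -/
def Filtration.Stratum (F : Filtration X n) : Type u :=
  Σ i : Fin (n + 1), ConnectedComponents (F.pure i)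

namespace Filtration.Stratum

variable {F : Filtration X n}

/-- The stratum as a subset of `X`. -/
def carrier (S : F.Stratum) : Set X :=
  {x | ∃ h : x ∈ F.pure S.1, (ConnectedComponents.mk ⟨x, h⟩ : ConnectedComponents (F.pure S.1)) = S.2}

/-- The formal codimension `n - i` of a stratum in `X_i \ X_{i-1}`. -/
def codim (S : F.Stratum) : ℤ := (n : ℤ) - ((S.1 : ℕ) : ℤ)

/-- The regular strata are those in `X_n \ X_{n-1}`; the others are singular. -/
def IsSingular (S : F.Stratum) : Prop := S.1 ≠ Fin.last n

end Filtration.Stratum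

/-- Every point has a neighbourhood that meets only finitely many strata. -/
def Filtration.LocallyFinite (F : Filtration X n) : Prop :=
  ∀ x : X, ∃ N ∈ 𝓝 x, {S : F.Stratum | (S.carrier ∩ N).Nonempty}.Finite

/-- A perversity: a map from strata to the extended integers with value `0` on regular strata. -/
structure Perversity (F : Filtration X n) where
  toFun : F.Stratum → ExtInt
  regular : ∀ S : F.Stratum, ¬ S.IsSingular → toFun S = 0

/-- The filtration of `Y` induced by a continuous map `g : Y → X`; for the inclusion of a subspace
this is the induced filtration `U_i = U ∩ X_i`. -/
def Filtration.comap (F : Filtration X n) (g : C(Y, X)) : Filtration Y n where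
  level i := g ⁻¹' F.level i
  isClosed_level i := (F.isClosed_level i).preimage g.continuous
  mono _ _ h := Set.preimage_mono (F.mono h)
  level_last := by rw [F.level_last, Set.preimage_univ]

theorem Filtration.mapsTo_pure (F : Filtration X n) (g : C(Y, X)) (i : Fin (n + 1)) :
    Set.MapsTo g ((F.comap g).pure i) (F.pure i) := by
  rintro y ⟨h1, h2⟩
  refine ⟨h1, fun h => h2 ?_⟩
  simp only [Set.mem_iUnion] at h ⊢
  exact h

/-- The stratum `S^g` of `X` that contains the image of the stratum `S` of `Y`. -/
def Filtration.Stratum.map (F : Filtration X n) (g : C(Y, X)) (S : (F.comap g).Stratum) :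
    F.Stratum :=
  ⟨S.1, (g.continuous.restrict (F.mapsTo_pure g S.1)).connectedComponentsMap S.2⟩

/-- The pull-back perversity `S ↦ p (S^g)`; for the inclusion of an open subspace this is the
induced perversity. -/
def Perversity.comap {F : Filtration X n} (p : Perversity F) (g : C(Y, X)) :
    Perversity (F.comap g) where
  toFun S := p.toFun (S.map F g)
  regular S hS := p.regular (S.map F g) hS

/-! ### Singular simplexes and chains -/

/-- Singular `k`-simplexes of `X`. -/
abbrev Simplex (X : Type u) [TopologicalSpace X] (k : ℕ) : Type u :=
  C(stdSimplex ℝ (Fin (k + 1)), X)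

/-- The `i`-th face of a singular simplex. -/
def Simplex.face {k : ℕ} (i : Fin (k + 2)) (σ : Simplex X (k + 1)) : Simplex X k :=
  σ.comp ⟨stdSimplex.map i.succAbove, stdSimplex.continuous_map _⟩

theorem Simplex.face_face {k : ℕ} (σ : Simplex X (k + 2)) (i j : Fin (k + 2)) (h : i ≤ j) :
    (σ.face j.succ).face i = (σ.face i.castSucc).face j := by
  ext x
  simp only [Simplex.face, ContinuousMap.comp_apply, ContinuousMap.coe_mk,
    stdSimplex.map_comp_apply]
  congr 2
  funext y
  rw [Function.comp_apply, Function.comp_apply]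
  ext
  simp only [Fin.succAbove, Fin.lt_def, Fin.le_def] at h ⊢
  split_ifs <;> simp_all <;> omega

/-- The set `σ⁻¹(A)` as a subset of the affine space that contains the standard simplex. -/
def Simplex.preimage {k : ℕ} (σ : Simplex X k) (A : Set X) : Set (Fin (k + 1) → ℝ) :=
  Subtype.val '' (σ ⁻¹' A)

/-- `σ : Δ^k → X` is `p`-allowable: `dim σ⁻¹(S) ≤ k - codim S + p(S)` for each singular stratum
`S`, with the polyhedral dimension on the left-hand side. -/
def Allowable {F : Filtration X n} (p : Perversity F) {k : ℕ} (σ : Simplex X k) : Prop :=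
  ∀ S : F.Stratum, S.IsSingular →
    PolyDimLE (σ.preimage S.carrier) (ofInt ((k : ℤ) - S.codim) + p.toFun S)

section chains

variable (R : Type v) [CommRing R] (G : Type w) [AddCommGroup G] [Module R G]

/-- Singular `k`-chains of `X` with coefficients in `G`. -/
abbrev Chain (X : Type u) [TopologicalSpace X] (G : Type w) [AddCommGroup G] (k : ℕ) :
    Type (max u w) :=
  Simplex X k →₀ G

/-- The boundary `∂σ = ∑ (-1)^i ∂_i σ`. -/
def boundary (X : Type u) [TopologicalSpace X] (k : ℕ) : Chain X G (k + 1) →ₗ[R] Chain X G k :=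
  ∑ i : Fin (k + 2), (-1 : R) ^ (i : ℕ) • Finsupp.lmapDomain G R (Simplex.face i)

theorem boundary_boundary (X : Type u) [TopologicalSpace X] (k : ℕ) :
    boundary R G X k ∘ₗ boundary R G X (k + 1) = 0 := by
  refine Finsupp.lhom_ext fun σ g => ?_
  simp only [boundary, LinearMap.comp_apply, LinearMap.sum_apply, LinearMap.smul_apply,
    Finsupp.lmapDomain_apply, Finsupp.mapDomain_single, map_sum, map_smul, Finset.smul_sum,
    smul_smul, LinearMap.zero_apply]
  rw [← Finset.sum_product', ← Finset.sum_filter_add_sum_filter_not _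
    (fun ij : Fin (k + 3) × Fin (k + 2) => (ij.1 : ℕ) ≤ (ij.2 : ℕ)), ← eq_neg_iff_add_eq_zero,
    ← Finset.sum_neg_distrib]
  refine Finset.sum_bij'
    (fun ij h => (ij.2.succ, Fin.castLT ij.1
      (lt_of_le_of_lt (Finset.mem_filter.1 h).2 ij.2.isLt)))
    (fun ij h => (ij.2.castSucc, ij.1.pred (by
      intro h0
      have := (Finset.mem_filter.1 h).2
      simp [h0] at this)))
    ?_ ?_ ?_ ?_ ?_
  · rintro ⟨i, j⟩ h
    simp only [Finset.mem_filter, Finset.mem_product, Finset.mem_univ, true_and, and_self] at h ⊢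
    simp
    omega
  · rintro ⟨i, j⟩ h
    simp only [Finset.mem_filter, Finset.mem_product, Finset.mem_univ, true_and, and_self] at h ⊢
    simp
    omega
  · rintro ⟨i, j⟩ h
    simp
  · rintro ⟨i, j⟩ h
    simp
  · rintro ⟨i, j⟩ h
    have hij : (i : ℕ) ≤ (j : ℕ) := (Finset.mem_filter.1 h).2
    have hlt : (i : ℕ) < k + 2 := lt_of_le_of_lt hij j.isLt
    have := Simplex.face_face σ (Fin.castLT i hlt) j hij
    simp only [Fin.castSucc_castLT] at this
    simp only [this, Fin.val_succ, Fin.val_castLT, ← neg_smul]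
    congr 1
    ring

variable {F : Filtration X n} (p : Perversity F)

/-- The `p`-allowable chains: linear combinations of `p`-allowable simplexes. -/
def allowableChains (k : ℕ) : Submodule R (Chain X G k) :=
  Finsupp.supported G R {σ : Simplex X k | Allowable p σ}

/-- The chains of `p`-intersection: `ξ` and `∂ξ` are `p`-allowable. -/
def interChains : (k : ℕ) → Submodule R (Chain X G k)
  | 0 => allowableChains R G p 0
  | k + 1 => allowableChains R G p (k + 1) ⊓ (allowableChains R G p k).comap (boundary R G X k)

theorem interChains_le (k : ℕ) : interChains R G p k ≤ allowableChains R G p k := by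
  cases k with
  | zero => exact le_rfl
  | succ k => exact inf_le_left

theorem boundary_mem (k : ℕ) (ξ : Chain X G (k + 1)) (h : ξ ∈ interChains R G p (k + 1)) :
    boundary R G X k ξ ∈ interChains R G p k := by
  cases k with
  | zero => exact h.2
  | succ k =>
    refine ⟨h.2, ?_⟩
    have := LinearMap.congr_fun (boundary_boundary R G X k) ξ
    rw [LinearMap.comp_apply] at this
    change boundary R G X k (boundary R G X (k + 1) ξ) ∈ allowableChains R G p k
    rw [this]
    exact Submodule.zero_mem _

/-- The boundary on chains of `p`-intersection. -/
def interBoundary (k : ℕ) : interChains R G p (k + 1) →ₗ[R] interChains R G p k :=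
  (boundary R G X k).restrict (boundary_mem R G p k)

/-- The complex `C^p_*(X; G)` of singular chains of `p`-intersection. -/
def interComplex : ChainComplex (ModuleCat.{max u w} R) ℕ :=
  ChainComplex.of (fun k => ModuleCat.of R (interChains R G p k))
    (fun k => ModuleCat.ofHom (interBoundary R G p k)) (by
      intro k
      refine ModuleCat.hom_ext (LinearMap.ext fun ξ => Subtype.ext ?_)
      exact LinearMap.congr_fun (boundary_boundary R G X k) ξ.1)

/-- The `p`-intersection homology `H^p_k(X; G)`. -/
def interHomology (k : ℕ) : ModuleCat.{max u w} R :=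
  (interComplex R G p).homology k

end chains

/-! ### Induced maps -/

theorem Filtration.Stratum.map_mem {F : Filtration X n} (g : C(Y, X)) (S : (F.comap g).Stratum)
    {y : Y} (hy : y ∈ S.carrier) : g y ∈ (S.map F g).carrier := by
  obtain ⟨i, c⟩ := S
  obtain ⟨h, hc⟩ := hy
  refine ⟨F.mapsTo_pure g _ h, ?_⟩
  exact congrArg (g.continuous.restrict (F.mapsTo_pure g i)).connectedComponentsMap hc

theorem Filtration.Stratum.eq_of_mem {F : Filtration X n} (S T : F.Stratum) {x : X}
    (hS : x ∈ S.carrier) (hT : x ∈ T.carrier) : S = T := by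
  obtain ⟨i, a⟩ := S
  obtain ⟨j, b⟩ := T
  obtain ⟨hi, hS⟩ := hS
  obtain ⟨hj, hT⟩ := hT
  dsimp only at hi hj hS hT
  have hij : i = j := by
    by_contra hne
    rcases lt_or_gt_of_ne hne with h | h
    · exact hj.2 (Set.mem_biUnion (show i ∈ {k | k < j} from h) hi.1)
    · exact hi.2 (Set.mem_biUnion (show j ∈ {k | k < i} from h) hj.1)
  subst hij
  rw [← hS, ← hT]

theorem Filtration.Stratum.exists_of_mem {F : Filtration X n} (g : C(Y, X)) (T : F.Stratum) {y : Y}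
    (hy : g y ∈ T.carrier) :
    ∃ S : (F.comap g).Stratum, y ∈ S.carrier ∧ S.map F g = T := by
  have h := hy
  obtain ⟨⟨h1, h2⟩, -⟩ := h
  have hy' : y ∈ (F.comap g).pure T.1 := by
    refine ⟨h1, fun h => h2 ?_⟩
    simp only [Set.mem_iUnion] at h ⊢
    exact h
  refine ⟨⟨T.1, ConnectedComponents.mk ⟨y, hy'⟩⟩, ⟨hy', rfl⟩, ?_⟩
  exact eq_of_mem _ _ (map_mem g _ ⟨hy', rfl⟩) hy

/-- An allowable simplex for the induced structure is allowable after composition. -/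
theorem Allowable.comp {F : Filtration X n} {p : Perversity F} (g : C(Y, X))
    (hfin : (F.comap g).LocallyFinite) {k : ℕ} {σ : Simplex Y k}
    (h : Allowable (p.comap g) σ) : Allowable p (g.comp σ : Simplex X k) := by
  intro T hT
  have hJ : {S : (F.comap g).Stratum | (S.carrier ∩ Set.range σ).Nonempty}.Finite := by
    choose N hN hNfin using hfin
    have hc : IsCompact (Set.range σ) := by
      have : CompactSpace (stdSimplex ℝ (Fin (k + 1))) :=
        isCompact_iff_compactSpace.1 (isCompact_stdSimplex ℝ _)
      exact isCompact_range σ.continuous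
    obtain ⟨t, -, ht⟩ := hc.elim_nhds_subcover N (fun x _ => hN x)
    refine (t.finite_toSet.biUnion (fun x _ => hNfin x)).subset ?_
    rintro S ⟨y, hyS, hy⟩
    obtain ⟨x, hx, hyx⟩ := Set.mem_iUnion₂.1 (ht hy)
    exact Set.mem_biUnion (show x ∈ (t : Set Y) from hx) ⟨y, hyS, hyx⟩
  have hI : {S : (F.comap g).Stratum |
      S.map F g = T ∧ (S.carrier ∩ Set.range σ).Nonempty}.Finite :=
    hJ.subset fun S hS => hS.2
  refine (PolyDimLE.biUnion hI (A := fun S => σ.preimage S.carrier) ?_).mono ?_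
  · rintro S ⟨rfl, -⟩
    exact h S hT
  · rintro _ ⟨x, hx, rfl⟩
    obtain ⟨S, hS, hST⟩ := Filtration.Stratum.exists_of_mem g T (y := σ x) hx
    exact Set.mem_biUnion (show S ∈ {S : (F.comap g).Stratum |
      S.map F g = T ∧ (S.carrier ∩ Set.range σ).Nonempty} from
        ⟨hST, ⟨σ x, hS, Set.mem_range_self x⟩⟩) ⟨x, hS, rfl⟩

/-- Conversely, a simplex is allowable for the induced structure if it is so after composition. -/
theorem Allowable.of_comp {F : Filtration X n} {p : Perversity F} (g : C(Y, X))
    {k : ℕ} {σ : Simplex Y k} (h : Allowable p (g.comp σ : Simplex X k)) :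
    Allowable (p.comap g) σ := by
  intro S hS
  refine (h (S.map F g) hS).mono ?_
  rintro _ ⟨x, hx, rfl⟩
  exact ⟨x, Filtration.Stratum.map_mem g S hx, rfl⟩

section maps

variable (R : Type v) [CommRing R] (G : Type w) [AddCommGroup G] [Module R G]

/-- The map `σ ↦ g ∘ σ` on singular chains. -/
def chainMap (g : C(Y, X)) (k : ℕ) : Chain Y G k →ₗ[R] Chain X G k :=
  Finsupp.lmapDomain G R fun σ : Simplex Y k => (g.comp σ : Simplex X k)

theorem chainMap_boundary (g : C(Y, X)) (k : ℕ) (ξ : Chain Y G (k + 1)) :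
    boundary R G X k (chainMap R G g (k + 1) ξ) = chainMap R G g k (boundary R G Y k ξ) := by
  induction ξ using Finsupp.induction_linear with
  | zero => simp
  | add a b ha hb => simp only [map_add, ha, hb]
  | single σ c =>
    simp only [boundary, chainMap, LinearMap.sum_apply, LinearMap.smul_apply,
      Finsupp.lmapDomain_apply, Finsupp.mapDomain_single, map_sum, map_smul]
    rfl

theorem chainMap_mem {F : Filtration X n} {p : Perversity F} {F' : Filtration Y n}
    {p' : Perversity F'} (g : C(Y, X))
    (hg : ∀ (k : ℕ) (σ : Simplex Y k), Allowable p' σ → Allowable p (g.comp σ : Simplex X k))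
    (k : ℕ) (ξ : Chain Y G k) (h : ξ ∈ interChains R G p' k) :
    chainMap R G g k ξ ∈ interChains R G p k := by
  have key : ∀ (k : ℕ) (ξ : Chain Y G k), ξ ∈ allowableChains R G p' k →
      chainMap R G g k ξ ∈ allowableChains R G p k := by
    intro k ξ hξ
    classical
    rw [allowableChains, Finsupp.mem_supported] at hξ ⊢
    intro τ hτ
    obtain ⟨σ, hσ, rfl⟩ := Finset.mem_image.1 (Finsupp.mapDomain_support hτ)
    exact hg k σ (hξ hσ)
  cases k with
  | zero => exact key 0 ξ h
  | succ k =>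
    refine ⟨key _ ξ h.1, ?_⟩
    change boundary R G X k (chainMap R G g (k + 1) ξ) ∈ allowableChains R G p k
    rw [chainMap_boundary]
    exact key _ _ h.2

/-- The chain map `C^{p'}_*(Y; G) → C^p_*(X; G)`, `σ ↦ g ∘ σ`, induced by a continuous map that
preserves allowable simplexes. -/
def interMap {F : Filtration X n} {p : Perversity F} {F' : Filtration Y n}
    {p' : Perversity F'} (g : C(Y, X))
    (hg : ∀ (k : ℕ) (σ : Simplex Y k), Allowable p' σ → Allowable p (g.comp σ : Simplex X k)) :
    interComplex R G p' ⟶ interComplex R G p :=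
  ChainComplex.ofHom
    (fun k => ModuleCat.ofHom ((chainMap R G g k).restrict (chainMap_mem R G g hg k)))
    (by
      intro k
      simp only [interComplex, ChainComplex.of_d]
      refine ModuleCat.hom_ext (LinearMap.ext fun ξ => Subtype.ext ?_)
      exact chainMap_boundary R G g k ξ.1)

/-- The induced map in intersection homology. -/
def homologyMap {F : Filtration X n} {p : Perversity F} {F' : Filtration Y n}
    {p' : Perversity F'} (g : C(Y, X))
    (hg : ∀ (k : ℕ) (σ : Simplex Y k), Allowable p' σ → Allowable p (g.comp σ : Simplex X k))
    (k : ℕ) : interHomology R G p' k →ₗ[R] interHomology R G p k :=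
  (HomologicalComplex.homologyMap (interMap R G g hg) k).hom

end maps

/-! ### Open subspaces -/

/-- The inclusion of an open subset. -/
def incl (U : Opens X) : C(U, X) := ⟨Subtype.val, continuous_subtype_val⟩

/-- The inclusion of an open subset in a larger one. -/
def inclLE {U V : Opens X} (h : U ≤ V) : C(U, V) := ⟨Set.inclusion h, continuous_inclusion h⟩

/-- The induced filtration of an open subset. -/
abbrev Filtration.on (F : Filtration X n) (U : Opens X) : Filtration U n := F.comap (incl U)

/-- The induced perversity on an open subset. -/
abbrev Perversity.on {F : Filtration X n} (p : Perversity F) (U : Opens X) :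
    Perversity (F.on U) := p.comap (incl U)

section opens

variable (R : Type v) [CommRing R] (G : Type w) [AddCommGroup G] [Module R G]
  {F : Filtration X n} (p : Perversity F)

/-- The map `H^p_k(U; G) → H^p_k(X; G)` induced by the inclusion of an open subset with locally
finite stratification. -/
def inclHomology (U : Opens X) (hU : (F.on U).LocallyFinite) (k : ℕ) :
    interHomology R G (p.on U) k →ₗ[R] interHomology R G p k :=
  homologyMap R G (incl U) (fun _ _ h => Allowable.comp (incl U) hU h) k

/-- The map `H^p_k(U; G) → H^p_k(V; G)` induced by the inclusion of open subsets `U ⊆ V`, where `U`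
has locally finite stratification. -/
def inclLEHomology {U V : Opens X} (hUV : U ≤ V) (hU : (F.on U).LocallyFinite) (k : ℕ) :
    interHomology R G (p.on U) k →ₗ[R] interHomology R G (p.on V) k :=
  homologyMap R G (inclLE hUV)
    (fun _ σ h => Allowable.of_comp (incl V) (σ := (inclLE hUV).comp σ)
      (Allowable.comp (incl U) hU h)) k

end opens

end

end PolyIH

/-! The difficulty is to cut an intersection chain into a piece in `U` and a piece in `V`: the
individual simplexes of a subdivided chain may have non-allowable faces that cancel only in the
whole boundary, so an arbitrary grouping of them creates non-allowable boundary.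

The cure is to group by original vertices. A simplex of the subdivision of `σ` is a full flag of
faces of `σ`, listed downwards, so its last vertex is a vertex of `σ`. Given a label set `L ⊆ X`,
keep the simplexes whose last vertex is sent into `L`. By `affineBoundary_subdivision` the boundary
of this partial subdivision is the partial subdivision of `∂ξ`, which is allowable with `∂ξ`, minus
dual simplexes spanned by the chosen points of the faces of positive dimension. A dual simplex spans
a hyperplane. By `polyDimLE_iff`, allowability says that `σ⁻¹(S)` is covered by finitely many linear
subspaces of bounded dimension, and a hyperplane that contains none of them lowers each dimension by
one, which is what a simplex of one dimension less must satisfy. So the subdivision points are not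
barycenters but points in general position (`exists_generic_pointChoice`); then every partial
subdivision is an intersection chain (`exists_partialSubdivision_mem_interChains`).

Iterated barycentric subdivision first makes the simplexes small, and separation of two disjoint
compact sets gives an `L` for which simplexes with a point in `L` lie in `U` and those with a point
outside `L` lie in `V` (`exists_small_iteratedSubdivision`). One generic subdivision, split by `L`
and its complement, is then a sum of intersection chains in `U` and in `V`. All subdivisions are
homotopic to the identity through operators that preserve intersection chains and supports.

Hence cycles are homologous to small cycles (`exists_small_cycle`), and a small boundary bounds a
small chain (`exists_small_bounding`). These two facts, with the identification of chains in `U ∩ V`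
as chains in both, yield the sequence by pure algebra (`exact_mayerVietoris`). -/

namespace PolyIH

open Topology TopologicalSpace

noncomputable section

universe u v w

variable {X : Type u} [TopologicalSpace X]

/-! ### Homology classes of a complex of modules -/

section HomologyClass

open CategoryTheory

universe u₁ v₁

variable {R : Type v₁} [CommRing R]

/-- The cycles of degree `k` as a submodule. -/
abbrev cycleSubmodule (K : ChainComplex (ModuleCat.{u₁} R) ℕ) (k : ℕ) : Submodule R (K.X k) :=
  LinearMap.ker (K.d k (k - 1)).hom

/-- Truncated subtraction is harmless here: for `k = 0` the differential in `cycleSubmodule` is `d 0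
0`, which vanishes, so all chains of degree `0` are cycles. -/
theorem next_eq_pred (k : ℕ) : (ComplexShape.down ℕ).next k = k - 1 := by
  cases k with
  | zero => exact ChainComplex.next_nat_zero
  | succ k => exact ChainComplex.next_nat_succ k

/-- A cycle as a map into the cycles object. -/
def toCyclesObj (K : ChainComplex (ModuleCat.{u₁} R) ℕ) (k : ℕ) :
    ModuleCat.of R (cycleSubmodule K k) ⟶ K.cycles k :=
  K.liftCycles (ModuleCat.ofHom (cycleSubmodule K k).subtype) (k - 1) (next_eq_pred k)
    (ModuleCat.hom_ext (LinearMap.ext fun z => z.2))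

theorem iCycles_toCyclesObj (K : ChainComplex (ModuleCat.{u₁} R) ℕ) (k : ℕ)
    (z : cycleSubmodule K k) : (K.iCycles k).hom ((toCyclesObj K k).hom z) = z.1 := by
  have := K.liftCycles_i (ModuleCat.ofHom (cycleSubmodule K k).subtype) (k - 1) (next_eq_pred k)
    (ModuleCat.hom_ext (LinearMap.ext fun z => z.2))
  exact LinearMap.congr_fun (congrArg ModuleCat.Hom.hom this) z

theorem iCycles_injective (K : ChainComplex (ModuleCat.{u₁} R) ℕ) (k : ℕ) :
    Function.Injective (K.iCycles k).hom :=
  (ModuleCat.mono_iff_injective _).1 inferInstance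

/-- The homology class of a cycle. -/
def homologyClass (K : ChainComplex (ModuleCat.{u₁} R) ℕ) (k : ℕ) :
    cycleSubmodule K k →ₗ[R] K.homology k :=
  (toCyclesObj K k ≫ K.homologyπ k).hom

theorem homologyClass_surjective (K : ChainComplex (ModuleCat.{u₁} R) ℕ) (k : ℕ) :
    Function.Surjective (homologyClass K k) := by
  intro c
  obtain ⟨y, rfl⟩ := (ModuleCat.epi_iff_surjective (K.homologyπ k)).1 inferInstance c
  have hy : (K.d k (k - 1)).hom ((K.iCycles k).hom y) = 0 :=
    LinearMap.congr_fun (congrArg ModuleCat.Hom.hom (K.iCycles_d k (k - 1))) y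
  refine ⟨⟨(K.iCycles k).hom y, hy⟩, ?_⟩
  have : (toCyclesObj K k).hom ⟨(K.iCycles k).hom y, hy⟩ = y :=
    iCycles_injective K k (iCycles_toCyclesObj K k _)
  change (K.homologyπ k).hom ((toCyclesObj K k).hom _) = _
  rw [this]

/-- Homology is the cokernel of `toCycles`, so the kernel of the projection from the cycles is the
image of the differential. -/
theorem homologyClass_eq_zero_iff (K : ChainComplex (ModuleCat.{u₁} R) ℕ) (k : ℕ)
    (z : cycleSubmodule K k) :
    homologyClass K k z = 0 ↔ ∃ y : K.X (k + 1), (K.d (k + 1) k).hom y = z.1 := by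
  have hex := ShortComplex.exact_of_g_is_cokernel
    (ShortComplex.mk _ _ (K.toCycles_comp_homologyπ (k + 1) k))
    (K.homologyIsCokernel (k + 1) k (ChainComplex.prev ℕ k))
  rw [ShortComplex.moduleCat_exact_iff] at hex
  constructor
  · intro h
    obtain ⟨y, hy⟩ := hex ((toCyclesObj K k).hom z) h
    refine ⟨y, ?_⟩
    rw [← iCycles_toCyclesObj K k z, ← hy]
    exact (LinearMap.congr_fun (congrArg ModuleCat.Hom.hom (K.toCycles_i (k + 1) k)) y).symm
  · rintro ⟨y, hy⟩
    have h1 : (K.toCycles (k + 1) k).hom y = (toCyclesObj K k).hom z := by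
      apply iCycles_injective K k
      rw [iCycles_toCyclesObj, ← hy]
      exact LinearMap.congr_fun (congrArg ModuleCat.Hom.hom (K.toCycles_i (k + 1) k)) y
    change (K.homologyπ k).hom ((toCyclesObj K k).hom z) = 0
    rw [← h1]
    exact LinearMap.congr_fun (congrArg ModuleCat.Hom.hom (K.toCycles_comp_homologyπ (k + 1) k)) y

variable {K K' : ChainComplex (ModuleCat.{u₁} R) ℕ}

theorem hom_d_apply (φ : K ⟶ K') (i j : ℕ) (x : K.X i) :
    (K'.d i j).hom ((φ.f i).hom x) = (φ.f j).hom ((K.d i j).hom x) :=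
  LinearMap.congr_fun (congrArg ModuleCat.Hom.hom (φ.comm i j)) x

theorem d_d_apply (i j l : ℕ) (x : K.X i) : (K.d j l).hom ((K.d i j).hom x) = 0 :=
  LinearMap.congr_fun (congrArg ModuleCat.Hom.hom (K.d_comp_d i j l)) x

theorem map_mem_cycleSubmodule (φ : K ⟶ K') {k : ℕ} (z : cycleSubmodule K k) :
    (φ.f k).hom z.1 ∈ cycleSubmodule K' k := by
  rw [LinearMap.mem_ker, hom_d_apply, LinearMap.mem_ker.1 z.2, map_zero]

theorem homologyMap_homologyClass (φ : K ⟶ K') {k : ℕ} (z : cycleSubmodule K k) :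
    (HomologicalComplex.homologyMap φ k).hom (homologyClass K k z) =
      homologyClass K' k ⟨(φ.f k).hom z.1, map_mem_cycleSubmodule φ z⟩ := by
  have h1 : (HomologicalComplex.cyclesMap φ k).hom ((toCyclesObj K k).hom z) =
      (toCyclesObj K' k).hom ⟨(φ.f k).hom z.1, map_mem_cycleSubmodule φ z⟩ := by
    apply iCycles_injective K' k
    rw [iCycles_toCyclesObj]
    have := LinearMap.congr_fun (congrArg ModuleCat.Hom.hom (HomologicalComplex.cyclesMap_i φ k))
      ((toCyclesObj K k).hom z)
    refine this.trans ?_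
    change (φ.f k).hom ((K.iCycles k).hom ((toCyclesObj K k).hom z)) = _
    rw [iCycles_toCyclesObj]
  change _ = (K'.homologyπ k).hom ((toCyclesObj K' k).hom _)
  rw [← h1]
  exact LinearMap.congr_fun
    (congrArg ModuleCat.Hom.hom (HomologicalComplex.homologyπ_naturality φ k))
      ((toCyclesObj K k).hom z)

end HomologyClass

/-! ### The algebraic Mayer-Vietoris sequence -/

section AlgebraicMayerVietoris

open CategoryTheory

universe u₁ v₁

variable {R : Type v₁} [CommRing R] {A B C D : ChainComplex (ModuleCat.{u₁} R) ℕ}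
  (iB : A ⟶ B) (iC : A ⟶ C) (jB : B ⟶ D) (jC : C ⟶ D)

/-- Pairs of chains whose sum is a cycle of degree `k + 1`. -/
def pairCycles (k : ℕ) : Submodule R (B.X (k + 1) × C.X (k + 1)) :=
  LinearMap.ker ((D.d (k + 1) k).hom ∘ₗ ((jB.f (k + 1)).hom.coprod (jC.f (k + 1)).hom))

theorem mem_pairCycles {k : ℕ} (x : B.X (k + 1) × C.X (k + 1)) :
    x ∈ pairCycles jB jC k ↔ (jB.f k).hom ((B.d (k + 1) k).hom x.1) +
      (jC.f k).hom ((C.d (k + 1) k).hom x.2) = 0 := by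
  simp [pairCycles, hom_d_apply]

/-- The homology class of the sum of a pair of chains. -/
def pairSum (k : ℕ) : pairCycles jB jC k →ₗ[R] D.homology (k + 1) :=
  homologyClass D (k + 1) ∘ₗ
    (((jB.f (k + 1)).hom.coprod (jC.f (k + 1)).hom).restrict (fun _ h => h))

/-- Subtracting a boundary from a cycle of `D` leaves a sum `b + c` in the same class. -/
theorem pairSum_surjective
    (hcyc : ∀ k, ∀ z ∈ cycleSubmodule D k, ∃ b c y,
      z = (jB.f k).hom b + (jC.f k).hom c + (D.d (k + 1) k).hom y) (k : ℕ) :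
    Function.Surjective (pairSum jB jC k) := by
  intro c
  obtain ⟨z, rfl⟩ := homologyClass_surjective D (k + 1) c
  obtain ⟨b, c, y, h⟩ := hcyc (k + 1) z.1 z.2
  have hbc : (b, c) ∈ pairCycles jB jC k := by
    have h0 : (D.d (k + 1) k).hom z.1 = 0 := z.2
    rw [h, map_add, d_d_apply, add_zero, map_add, hom_d_apply, hom_d_apply] at h0
    exact (mem_pairCycles jB jC _).2 h0
  refine ⟨⟨(b, c), hbc⟩, ?_⟩
  rw [← sub_eq_zero]
  simp only [pairSum, LinearMap.comp_apply]
  rw [← map_sub, homologyClass_eq_zero_iff]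
  refine ⟨-y, ?_⟩
  rw [map_neg]
  change _ = ((jB.f (k + 1)).hom b + (jC.f (k + 1)).hom c) - z.1
  rw [h]
  abel

/-- The rule is the usual one: represent the class by `b + c` and take the element of `A` that maps
to `∂b = -∂c`. It is defined on pairs and descends through `pairSum`; `hrel` makes it well defined.
-/
theorem exists_connectingMap
    (hiB : ∀ k, Function.Injective (iB.f k).hom)
    (hpull : ∀ k b c, (jB.f k).hom b = (jC.f k).hom c → ∃ a, (iB.f k).hom a = b)
    (hcyc : ∀ k, ∀ z ∈ cycleSubmodule D k, ∃ b c y,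
      z = (jB.f k).hom b + (jC.f k).hom c + (D.d (k + 1) k).hom y)
    (hrel : ∀ k (z : D.X (k + 1)) b c, (D.d (k + 1) k).hom z = (jB.f k).hom b + (jC.f k).hom c →
      ∃ b' c', (D.d (k + 1) k).hom z = (jB.f k).hom ((B.d (k + 1) k).hom b') +
        (jC.f k).hom ((C.d (k + 1) k).hom c'))
    (k : ℕ) :
    ∃ δ : D.homology (k + 1) →ₗ[R] A.homology k,
      ∀ (x : pairCycles jB jC k) (a : cycleSubmodule A k),
        (iB.f k).hom a.1 = (B.d (k + 1) k).hom x.1.1 →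
          δ (pairSum jB jC k x) = homologyClass A k a := by
  have hcyA : ∀ (a : A.X k) (b : B.X (k + 1)), (iB.f k).hom a = (B.d (k + 1) k).hom b →
      a ∈ cycleSubmodule A k := by
    intro a b h
    apply hiB (k - 1)
    rw [map_zero, ← hom_d_apply, h, d_d_apply]
  have hex : ∀ x : pairCycles jB jC k, ∃ a, (iB.f k).hom a = (B.d (k + 1) k).hom x.1.1 := by
    intro x
    refine hpull k _ (-(C.d (k + 1) k).hom x.1.2) ?_
    rw [map_neg, ← add_eq_zero_iff_eq_neg]
    exact (mem_pairCycles jB jC x.1).1 x.2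
  choose a ha using hex
  -- The preimages `a x` are merely chosen; injectivity of `iB` makes the choice unique and
  -- therefore linear.
  let θ : pairCycles jB jC k →ₗ[R] A.homology k :=
    homologyClass A k ∘ₗ
      { toFun := fun x => ⟨a x, hcyA _ _ (ha x)⟩
        map_add' := fun x y => Subtype.ext <| hiB k <| by simp [ha]
        map_smul' := fun r x => Subtype.ext <| hiB k <| by simp [ha] }
  have hsurj := LinearMap.range_eq_top.2 (pairSum_surjective jB jC hcyc k)
  -- If `b + c` is a boundary, then by `hrel` it is `∂b' + ∂c'`. So `b - ∂b' = ∂c' - c` in `D` comes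
  -- from some `e` in `A`, and `∂e` is the given preimage of `∂b`.
  have hker : LinearMap.ker (pairSum jB jC k) ≤ LinearMap.ker θ := by
    intro x hx
    obtain ⟨y, hy⟩ := (homologyClass_eq_zero_iff D (k + 1) _).1 hx
    obtain ⟨b', c', h⟩ := hrel (k + 1) y x.1.1 x.1.2 hy
    have h2 : (jB.f (k + 1)).hom x.1.1 + (jC.f (k + 1)).hom x.1.2 =
      (jB.f (k + 1)).hom ((B.d (k + 1 + 1) (k + 1)).hom b') +
        (jC.f (k + 1)).hom ((C.d (k + 1 + 1) (k + 1)).hom c') := hy.symm.trans h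
    obtain ⟨e, he⟩ := hpull (k + 1) (x.1.1 - (B.d (k + 1 + 1) (k + 1)).hom b')
      ((C.d (k + 1 + 1) (k + 1)).hom c' - x.1.2) (by
        rw [map_sub, map_sub, sub_eq_sub_iff_add_eq_add, h2]; exact add_comm _ _)
    refine (homologyClass_eq_zero_iff A k _).2 ⟨e, hiB k ?_⟩
    rw [← hom_d_apply, he, map_sub, d_d_apply, sub_zero]
    exact (ha x).symm
  let e := LinearMap.quotKerEquivOfSurjective _ (LinearMap.range_eq_top.1 hsurj)
  refine ⟨(LinearMap.ker (pairSum jB jC k)).liftQ θ hker ∘ₗ e.symm.toLinearMap, ?_⟩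
  intro x a' ha'
  have he : e.symm (pairSum jB jC k x) = (LinearMap.ker (pairSum jB jC k)).mkQ x := by
    rw [LinearEquiv.symm_apply_eq]
    rfl
  rw [LinearMap.comp_apply, LinearEquiv.coe_coe, he, Submodule.mkQ_apply, Submodule.liftQ_apply]
  refine congrArg (homologyClass A k) (Subtype.ext (hiB k ?_))
  exact (ha x).trans ha'.symm

/-- `hcyc` and `hrel` together say that the inclusion of the sums `B + C` in `D` is bijective on
homology, and `hpull` says that `A` is the intersection of `B` and `C`. The proof is a diagram chase
with representatives. -/
theorem exact_mayerVietoris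
    (hiB : ∀ k, Function.Injective (iB.f k).hom)
    (hjC : ∀ k, Function.Injective (jC.f k).hom)
    (hcomm : ∀ k a, (jB.f k).hom ((iB.f k).hom a) = (jC.f k).hom ((iC.f k).hom a))
    (hpull : ∀ k b c, (jB.f k).hom b = (jC.f k).hom c → ∃ a, (iB.f k).hom a = b)
    (hcyc : ∀ k, ∀ z ∈ cycleSubmodule D k, ∃ b c y,
      z = (jB.f k).hom b + (jC.f k).hom c + (D.d (k + 1) k).hom y)
    (hrel : ∀ k (z : D.X (k + 1)) b c, (D.d (k + 1) k).hom z = (jB.f k).hom b + (jC.f k).hom c →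
      ∃ b' c', (D.d (k + 1) k).hom z = (jB.f k).hom ((B.d (k + 1) k).hom b') +
        (jC.f k).hom ((C.d (k + 1) k).hom c')) :
    ∃ δ : ∀ k : ℕ, D.homology (k + 1) →ₗ[R] A.homology k,
      (∀ k, Function.Exact
        ((HomologicalComplex.homologyMap iB k).hom.prod (-(HomologicalComplex.homologyMap iC k).hom))
        ((HomologicalComplex.homologyMap jB k).hom.coprod
          (HomologicalComplex.homologyMap jC k).hom)) ∧
      (∀ k, Function.Exact
        ((HomologicalComplex.homologyMap jB (k + 1)).hom.coprod
          (HomologicalComplex.homologyMap jC (k + 1)).hom) (δ k)) ∧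
      (∀ k, Function.Exact (δ k)
        ((HomologicalComplex.homologyMap iB k).hom.prod
          (-(HomologicalComplex.homologyMap iC k).hom))) ∧
      Function.Surjective ((HomologicalComplex.homologyMap jB 0).hom.coprod
          (HomologicalComplex.homologyMap jC 0).hom) := by
  choose δ hδ using exists_connectingMap iB jB jC hiB hpull hcyc hrel
  have hsurj := pairSum_surjective jB jC hcyc
  have hlift : ∀ k (x : pairCycles jB jC k), ∃ a : cycleSubmodule A k,
      (iB.f k).hom a.1 = (B.d (k + 1) k).hom x.1.1 ∧
      (iC.f k).hom a.1 = -(C.d (k + 1) k).hom x.1.2 := by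
    intro k x
    have hx := (mem_pairCycles jB jC x.1).1 x.2
    rw [add_eq_zero_iff_eq_neg, ← map_neg] at hx
    obtain ⟨a, ha⟩ := hpull k _ _ hx
    refine ⟨⟨a, hiB (k - 1) ?_⟩, ha, hjC k ?_⟩
    · rw [map_zero, ← hom_d_apply, ha, d_d_apply]
    · exact (hcomm k a).symm.trans ((congrArg _ ha).trans hx)
  refine ⟨δ, fun k => ?_, fun k => ?_, fun k => ?_, ?_⟩
  · rintro ⟨β, γ⟩
    constructor
    · intro h
      obtain ⟨b, rfl⟩ := homologyClass_surjective B k β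
      obtain ⟨c, rfl⟩ := homologyClass_surjective C k γ
      rw [LinearMap.coprod_apply, homologyMap_homologyClass, homologyMap_homologyClass, ← map_add,
        homologyClass_eq_zero_iff] at h
      obtain ⟨y, hy⟩ := h
      -- After replacing the bounding chain by `b' + c'`, the difference `b - ∂b' = ∂c' - c` lies in
      -- both subcomplexes and yields the class in `A`.
      obtain ⟨b', c', h⟩ := hrel k y b.1 c.1 hy
      have h2 : (jB.f k).hom b.1 + (jC.f k).hom c.1 = (jB.f k).hom ((B.d (k + 1) k).hom b') +
        (jC.f k).hom ((C.d (k + 1) k).hom c') := hy.symm.trans h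
      have h3 : (jB.f k).hom (b.1 - (B.d (k + 1) k).hom b') =
          (jC.f k).hom ((C.d (k + 1) k).hom c' - c.1) := by
        rw [map_sub, map_sub, sub_eq_sub_iff_add_eq_add, h2, add_comm]
      obtain ⟨a, ha⟩ := hpull k _ _ h3
      have ha' : (iC.f k).hom a = (C.d (k + 1) k).hom c' - c.1 := hjC k (by
        rw [← hcomm, ha, h3])
      have hacy : a ∈ cycleSubmodule A k := hiB (k - 1) (by
        rw [map_zero, ← hom_d_apply, ha, map_sub, d_d_apply, LinearMap.mem_ker.1 b.2, sub_zero])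
      refine ⟨homologyClass A k ⟨a, hacy⟩, Prod.ext ?_ ?_⟩
      · change (HomologicalComplex.homologyMap iB k).hom (homologyClass A k ⟨a, hacy⟩) = _
        rw [homologyMap_homologyClass, ← sub_eq_zero, ← map_sub, homologyClass_eq_zero_iff]
        refine ⟨-b', ?_⟩
        change _ = (iB.f k).hom a - b.1
        rw [ha, map_neg]
        abel
      · change -(HomologicalComplex.homologyMap iC k).hom (homologyClass A k ⟨a, hacy⟩) = _
        rw [homologyMap_homologyClass, ← sub_eq_zero, ← map_neg, ← map_sub,
          homologyClass_eq_zero_iff]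
        refine ⟨-c', ?_⟩
        change _ = -(iC.f k).hom a - c.1
        rw [ha', map_neg]
        abel
    · rintro ⟨α, h⟩
      obtain ⟨a, rfl⟩ := homologyClass_surjective A k α
      rw [← h]
      change (HomologicalComplex.homologyMap jB k).hom
          ((HomologicalComplex.homologyMap iB k).hom (homologyClass A k a)) +
        (HomologicalComplex.homologyMap jC k).hom
          (-(HomologicalComplex.homologyMap iC k).hom (homologyClass A k a)) = 0
      simp only [map_neg, homologyMap_homologyClass, hcomm]
      exact add_neg_cancel _
  · intro ζ
    constructor
    · intro h
      obtain ⟨x, rfl⟩ := hsurj k ζ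
      obtain ⟨a, ha, ha'⟩ := hlift k x
      rw [hδ k x a ha, homologyClass_eq_zero_iff] at h
      obtain ⟨y, hy⟩ := h
      -- Since `a = ∂y`, moving `y` from the first component to the second turns both into cycles
      -- and leaves their sum unchanged.
      have hb : x.1.1 - (iB.f (k + 1)).hom y ∈ cycleSubmodule B (k + 1) := by
        rw [LinearMap.mem_ker, map_sub, sub_eq_zero]
        exact ((hom_d_apply iB (k + 1) k y).trans ((congrArg _ hy).trans ha)).symm
      have hc : x.1.2 + (iC.f (k + 1)).hom y ∈ cycleSubmodule C (k + 1) := by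
        rw [LinearMap.mem_ker, map_add]
        exact (congrArg _ ((hom_d_apply iC (k + 1) k y).trans ((congrArg _ hy).trans ha'))).trans
          (add_neg_cancel _)
      refine ⟨(homologyClass B (k + 1) ⟨_, hb⟩, homologyClass C (k + 1) ⟨_, hc⟩), ?_⟩
      rw [LinearMap.coprod_apply, homologyMap_homologyClass, homologyMap_homologyClass, ← map_add]
      refine congrArg (homologyClass D (k + 1)) (Subtype.ext ?_)
      change (jB.f (k + 1)).hom (x.1.1 - (iB.f (k + 1)).hom y) +
        (jC.f (k + 1)).hom (x.1.2 + (iC.f (k + 1)).hom y) =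
          (jB.f (k + 1)).hom x.1.1 + (jC.f (k + 1)).hom x.1.2
      rw [map_sub, map_add, hcomm]
      abel
    · rintro ⟨⟨β, γ⟩, rfl⟩
      obtain ⟨b, rfl⟩ := homologyClass_surjective B (k + 1) β
      obtain ⟨c, rfl⟩ := homologyClass_surjective C (k + 1) γ
      have hb : (B.d (k + 1) k).hom b.1 = 0 := b.2
      have hc : (C.d (k + 1) k).hom c.1 = 0 := c.2
      have hx : (b.1, c.1) ∈ pairCycles jB jC k := by
        rw [mem_pairCycles, hb, hc, map_zero, map_zero, add_zero]
      have := hδ k ⟨_, hx⟩ 0 ((map_zero _).trans hb.symm)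
      rw [map_zero] at this
      rw [LinearMap.coprod_apply, homologyMap_homologyClass, homologyMap_homologyClass, ← map_add]
      exact this
  · intro α
    constructor
    · intro h
      obtain ⟨a, rfl⟩ := homologyClass_surjective A k α
      have h1 : (HomologicalComplex.homologyMap iB k).hom (homologyClass A k a) = 0 :=
        congrArg Prod.fst h
      have h2 : -(HomologicalComplex.homologyMap iC k).hom (homologyClass A k a) = 0 :=
        congrArg Prod.snd h
      rw [homologyMap_homologyClass, homologyClass_eq_zero_iff] at h1
      rw [neg_eq_zero, homologyMap_homologyClass, homologyClass_eq_zero_iff] at h2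
      obtain ⟨b, hb⟩ := h1
      obtain ⟨c, hc⟩ := h2
      have hx : (b, -c) ∈ pairCycles jB jC k := by
        rw [mem_pairCycles, map_neg, hb, hc, map_neg]
        exact (congrArg (· + _) (hcomm k a.1)).trans (add_neg_cancel _)
      exact ⟨_, hδ k ⟨_, hx⟩ a hb.symm⟩
    · rintro ⟨ζ, rfl⟩
      obtain ⟨x, rfl⟩ := hsurj k ζ
      obtain ⟨a, ha, ha'⟩ := hlift k x
      rw [hδ k x a ha]
      refine Prod.ext ?_ ?_
      · change (HomologicalComplex.homologyMap iB k).hom (homologyClass A k a) = 0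
        rw [homologyMap_homologyClass, homologyClass_eq_zero_iff]
        exact ⟨_, ha.symm⟩
      · change -(HomologicalComplex.homologyMap iC k).hom (homologyClass A k a) = 0
        rw [neg_eq_zero, homologyMap_homologyClass, homologyClass_eq_zero_iff]
        exact ⟨-x.1.2, by rw [map_neg]; exact ha'.symm⟩
  · intro ζ
    obtain ⟨z, rfl⟩ := homologyClass_surjective D 0 ζ
    obtain ⟨b, c, y, h⟩ := hcyc 0 z.1 z.2
    have hd0 : ∀ (K : ChainComplex (ModuleCat.{u₁} R) ℕ) (x : K.X 0), x ∈ cycleSubmodule K 0 := by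
      intro K x
      rw [LinearMap.mem_ker, K.shape 0 (0 - 1) (by simp)]
      rfl
    refine ⟨(homologyClass B 0 ⟨b, hd0 B b⟩, homologyClass C 0 ⟨c, hd0 C c⟩), ?_⟩
    rw [LinearMap.coprod_apply, homologyMap_homologyClass, homologyMap_homologyClass, ← map_add,
      ← sub_eq_zero, ← map_sub, homologyClass_eq_zero_iff]
    refine ⟨-y, ?_⟩
    change _ = (jB.f 0).hom b + (jC.f 0).hom c - z.1
    rw [h, map_neg]
    abel

end AlgebraicMayerVietoris

/-! ### Polyhedral dimension of subsets of the standard simplex -/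

/-- A bounded subset of a finite-dimensional space is included in a simplex of full dimension. -/
theorem exists_simplex_superset {V : Type*} [NormedAddCommGroup V] [NormedSpace ℝ V]
    [FiniteDimensional ℝ V] {B : Set V} (hB : Bornology.IsBounded B) :
    ∃ s : Finset V, IsSimplexVertices s ∧ s.card = Module.finrank ℝ V + 1 ∧
      B ⊆ convexHull ℝ (s : Set V) := by
  classical
  obtain ⟨b⟩ := AffineBasis.exists_affineBasis_of_finiteDimensional (k := ℝ) (V := V) (P := V)
    (ι := Fin (Module.finrank ℝ V + 1)) (by simp)
  set c := Finset.univ.centroid ℝ b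
  obtain ⟨r, hr, hrb⟩ := Metric.isOpen_iff.1 isOpen_interior c b.centroid_mem_interior_convexHull
  obtain ⟨M, hM⟩ := hB.subset_ball c
  -- The homothety maps the ball of radius `r` inside the hull onto one of radius `max M 1`, which
  -- contains `B`; the maximum keeps the ratio positive.
  have hrM : 0 < max M 1 / r := div_pos (lt_max_of_lt_right one_pos) hr
  let φ : V ≃ᵃ[ℝ] V := AffineEquiv.homothetyUnitsMulHom c (Units.mk0 _ hrM.ne')
  have hφ : ∀ x, φ x = AffineMap.homothety c (max M 1 / r) x := fun x => rfl
  have hinj : Function.Injective (φ ∘ b) := φ.injective.comp b.ind.injective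
  refine ⟨Finset.univ.image (φ ∘ b), ⟨Finset.univ_nonempty.image _, ?_⟩, ?_, ?_⟩
  · have h1 : AffineIndependent ℝ (φ ∘ b) :=
      (AffineEquiv.affineIndependent_iff φ).2 b.ind
    have h2 := h1.range
    have e : ((Finset.univ.image (φ ∘ b) : Finset V) : Set V) = Set.range (φ ∘ b) := by
      rw [Finset.coe_image, Finset.coe_univ, Set.image_univ]
    rw [← e] at h2
    exact h2
  · rw [Finset.card_image_of_injective _ hinj]
    simp
  · intro x hx
    have hx' := hM hx
    have e : ((Finset.univ.image (φ ∘ b) : Finset V) : Set V) = φ '' Set.range b := by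
      rw [Finset.coe_image, Finset.coe_univ, Set.image_univ, Set.range_comp]
    rw [e]
    have := AffineMap.image_convexHull (φ : V →ᵃ[ℝ] V) (Set.range b)
    rw [AffineEquiv.coe_toAffineMap] at this
    rw [← this]
    refine ⟨φ.symm x, interior_subset (hrb ?_), φ.apply_symm_apply x⟩
    have hd : dist x c = max M 1 / r * dist (φ.symm x) c := by
      conv_lhs => rw [← φ.apply_symm_apply x, hφ]
      rw [dist_homothety_center, Real.norm_of_nonneg hrM.le, dist_comm]
    rw [Metric.mem_ball] at hx' ⊢
    have h3 : max M 1 / r * dist (φ.symm x) c < max M 1 / r * r := by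
      rw [← hd, div_mul_cancel₀ _ hr.ne']
      exact hx'.trans_le (le_max_left _ _)
    exact lt_of_mul_lt_mul_left h3 hrM.le

/-- The part of a linear subspace in a standard simplex is included in a simplex whose number of
vertices is at most the dimension of the subspace. -/
theorem exists_simplex_superset_inter_stdSimplex {k : ℕ} (W : Submodule ℝ (Fin (k + 1) → ℝ))
    (hW : ((W : Set (Fin (k + 1) → ℝ)) ∩ stdSimplex ℝ (Fin (k + 1))).Nonempty) :
    ∃ s : Finset (Fin (k + 1) → ℝ), IsSimplexVertices s ∧ s.card ≤ Module.finrank ℝ W ∧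
      (W : Set (Fin (k + 1) → ℝ)) ∩ stdSimplex ℝ (Fin (k + 1)) ⊆ convexHull ℝ (s : Set _) := by
  classical
  obtain ⟨x₀, hx₀W, hx₀⟩ := hW
  let f : (Fin (k + 1) → ℝ) →ₗ[ℝ] ℝ := ∑ i, LinearMap.proj i
  have hf : ∀ x, f x = ∑ i, x i := fun x => by simp [f]
  let V : Submodule ℝ (Fin (k + 1) → ℝ) := W ⊓ LinearMap.ker f
  -- The point `x₀` has coordinate sum `1`, so the directions of sum zero form a smaller space; this
  -- pays for the extra vertex, as a full simplex in `V` has `finrank V + 1` vertices.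
  have hVW : V < W := by
    refine lt_of_le_of_ne inf_le_left fun h => ?_
    have : x₀ ∈ V := h ▸ hx₀W
    have h2 : f x₀ = 0 := this.2
    rw [hf, hx₀.2] at h2
    exact one_ne_zero h2
  have hcard := Submodule.finrank_lt_finrank_of_lt hVW
  let g : V →ᵃ[ℝ] (Fin (k + 1) → ℝ) :=
    V.subtype.toAffineMap + AffineMap.const ℝ V x₀
  have hg : ∀ v : V, g v = v.1 + x₀ := fun v => rfl
  have hginj : Function.Injective g := fun v w h => by
    rw [hg, hg] at h
    exact Subtype.ext (add_right_cancel h)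
  have hB : Bornology.IsBounded (g ⁻¹' stdSimplex ℝ (Fin (k + 1))) := by
    have h1 : Bornology.IsBounded (stdSimplex ℝ (Fin (k + 1))) :=
      (isCompact_stdSimplex ℝ (Fin (k + 1))).isBounded
    obtain ⟨M, hM⟩ := h1.subset_closedBall x₀
    refine (Metric.isBounded_closedBall (x := (0 : V)) (r := M)).subset fun v hv => ?_
    have := hM hv
    rw [hg, Metric.mem_closedBall, dist_eq_norm, add_sub_cancel_right] at this
    rw [mem_closedBall_zero_iff]
    exact this
  obtain ⟨s, hs, hsc, hsB⟩ := exists_simplex_superset hB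
  refine ⟨s.image g, ⟨hs.1.image _, ?_⟩, ?_, ?_⟩
  · have h1 : AffineIndependent ℝ (g ∘ (Subtype.val : {x // x ∈ s} → V)) :=
      hs.2.map' g hginj
    have h2 := h1.range
    have e : ((s.image g : Finset _) : Set (Fin (k + 1) → ℝ)) =
        Set.range (g ∘ (Subtype.val : {x // x ∈ s} → V)) := by
      rw [Set.range_comp, Subtype.range_coe_subtype]
      simp
    rw [← e] at h2
    exact h2
  · exact Finset.card_image_le.trans (by rw [hsc]; exact hcard)
  · rintro x ⟨hxW, hx⟩
    have hxV : x - x₀ ∈ V := by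
      refine ⟨W.sub_mem hxW hx₀W, ?_⟩
      change f (x - x₀) = 0
      rw [map_sub, hf, hf, hx.2, hx₀.2, sub_self]
    have hgx : g ⟨x - x₀, hxV⟩ = x := by rw [hg, sub_add_cancel]
    have h1 := AffineMap.image_convexHull g (s : Set V)
    rw [Finset.coe_image, ← h1]
    exact ⟨⟨x - x₀, hxV⟩, hsB (by rw [Set.mem_preimage, hgx]; exact hx), hgx⟩

theorem ofInt_mono {a b : ℤ} (h : a ≤ b) : ofInt a ≤ ofInt b :=
  WithBot.coe_le_coe.2 (WithTop.coe_le_coe.2 h)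

/-- A subset of a standard simplex has polyhedral dimension at most `d` if and only if it is
covered by finitely many linear subspaces of dimension at most `d + 1`. -/
theorem polyDimLE_iff {k : ℕ} {A : Set (Fin (k + 1) → ℝ)} (hA : A ⊆ stdSimplex ℝ (Fin (k + 1)))
    {d : ExtInt} :
    PolyDimLE A d ↔ ∃ T : Set (Submodule ℝ (Fin (k + 1) → ℝ)), T.Finite ∧
      (∀ W ∈ T, W ≠ ⊥ ∧ ofInt ((Module.finrank ℝ W : ℤ) - 1) ≤ d) ∧
        ∀ x ∈ A, ∃ W ∈ T, x ∈ W := by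
  classical
  constructor
  · rintro ⟨_, ⟨T, hT, rfl⟩, hAT⟩
    -- A zero span misses the standard simplex and can be dropped. Nonzero subspaces are needed
    -- later to supply test vectors.
    refine ⟨{W | W ≠ ⊥ ∧ ∃ s ∈ T, W = Submodule.span ℝ (s : Set _)},
      (Set.Finite.image (fun s : Finset (Fin (k + 1) → ℝ) =>
        Submodule.span ℝ (s : Set (Fin (k + 1) → ℝ))) T.finite_toSet).subset ?_,
      ?_, ?_⟩
    · rintro _ ⟨-, s, hs, rfl⟩
      exact ⟨s, hs, rfl⟩
    · rintro _ ⟨h0, s, hs, rfl⟩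
      refine ⟨h0, (ofInt_mono ?_).trans (hT s hs).2⟩
      have := finrank_span_finset_le_card (R := ℝ) s
      rw [Set.finrank] at this
      omega
    · intro x hx
      obtain ⟨s, hs, hxs⟩ := Set.mem_iUnion₂.1 (hAT hx)

      have hxspan : x ∈ Submodule.span ℝ (s : Set (Fin (k + 1) → ℝ)) :=
        convexHull_min Submodule.subset_span (Submodule.convex _) hxs
      refine ⟨_, ⟨fun h => ?_, s, hs, rfl⟩, hxspan⟩
      rw [h, Submodule.mem_bot] at hxspan
      have := (hA hx).2
      rw [hxspan] at this
      simp at this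
  · rintro ⟨T, hfin, hT, hAT⟩
    refine (PolyDimLE.biUnion hfin
      (A := fun W => (W : Set (Fin (k + 1) → ℝ)) ∩ stdSimplex ℝ (Fin (k + 1))) ?_).mono ?_
    · intro W hW
      by_cases hne : ((W : Set (Fin (k + 1) → ℝ)) ∩ stdSimplex ℝ (Fin (k + 1))).Nonempty
      · obtain ⟨s, hs, hcard, hsub⟩ := exists_simplex_superset_inter_stdSimplex W hne
        refine ⟨_, ⟨{s}, ?_, rfl⟩, by simpa using hsub⟩
        intro s' hs'
        rw [Finset.mem_singleton.1 hs']
        refine ⟨hs, (ofInt_mono ?_).trans (hT W hW).2⟩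
        omega
      · rw [Set.not_nonempty_iff_eq_empty.1 hne]
        exact ⟨∅, ⟨∅, by simp, by simp⟩, subset_rfl⟩
    · intro x hx
      obtain ⟨W, hW, hxW⟩ := hAT x hx
      exact Set.mem_biUnion hW ⟨hxW, hA hx⟩

/-- Perversity values may be infinite, so terms cannot be cancelled: `-∞` contradicts the
hypothesis, `+∞` is trivial, and the finite case is arithmetic. -/
theorem ofInt_le_add_of_le {a a' b b' : ℤ} {p : ExtInt} (h : ofInt a ≤ ofInt b + p)
    (hab : a' - a ≤ b' - b) : ofInt a' ≤ ofInt b' + p := by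
  induction p using WithBot.recBotCoe with
  | bot =>
    rw [WithBot.add_bot, le_bot_iff] at h
    exact absurd h WithBot.coe_ne_bot
  | coe p =>
    rw [ofInt, ofInt, ← WithBot.coe_add, WithBot.coe_le_coe] at h ⊢
    induction p using WithTop.recTopCoe with
    | top => exact le_top
    | coe p =>
      norm_cast at h ⊢
      omega

/-! ### Affine singular simplexes of the standard simplexes -/

/-- The standard simplex of dimension `k`. -/
abbrev Delta (k : ℕ) : Set (Fin (k + 1) → ℝ) := stdSimplex ℝ (Fin (k + 1))

/-- The linear map with the given values on the standard basis. -/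
def vertexSum {j k : ℕ} (w : Fin (j + 1) → Delta k) :
    (Fin (j + 1) → ℝ) →ₗ[ℝ] (Fin (k + 1) → ℝ) :=
  Fintype.linearCombination ℝ fun i => (w i).1

theorem vertexSum_apply {j k : ℕ} (w : Fin (j + 1) → Delta k) (x : Fin (j + 1) → ℝ) :
    vertexSum w x = ∑ i, x i • (w i).1 := rfl

theorem vertexSum_mem {j k : ℕ} (w : Fin (j + 1) → Delta k) (x : Delta j) :
    vertexSum w x.1 ∈ Delta k :=
  (convex_stdSimplex ℝ _).sum_mem (fun i _ => x.2.1 i) x.2.2 fun i _ => (w i).2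

/-- The affine simplex with given vertices. -/
def affineSimplex {j k : ℕ} (w : Fin (j + 1) → Delta k) : C(Delta j, Delta k) where
  toFun x := ⟨vertexSum w x.1, vertexSum_mem w x⟩
  continuous_toFun := by
    refine Continuous.subtype_mk ?_ _
    exact (LinearMap.continuous_of_finiteDimensional (vertexSum w)).comp continuous_subtype_val

theorem affineSimplex_coe {j k : ℕ} (w : Fin (j + 1) → Delta k) (x : Delta j) :
    (affineSimplex w x).1 = vertexSum w x.1 := rfl

theorem vertexSum_single {j k : ℕ} (w : Fin (j + 1) → Delta k) (i : Fin (j + 1)) :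
    vertexSum w (Pi.single i 1) = (w i).1 := by
  rw [vertexSum, Fintype.linearCombination_apply_single, one_smul]

theorem affineSimplex_vertex {j k : ℕ} (w : Fin (j + 1) → Delta k) (i : Fin (j + 1)) :
    affineSimplex w (stdSimplex.vertex i) = w i :=
  Subtype.ext (vertexSum_single w i)

theorem vertexSum_vertexSum {i j k : ℕ} (w : Fin (j + 1) → Delta k) (w' : Fin (i + 1) → Delta j)
    (x : Fin (i + 1) → ℝ) :
    vertexSum w (vertexSum w' x) = vertexSum (affineSimplex w ∘ w') x := by
  rw [vertexSum_apply w', map_sum, vertexSum_apply]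
  refine Finset.sum_congr rfl fun l _ => ?_
  rw [map_smul, Function.comp_apply, affineSimplex_coe]

theorem vertexSum_vertices {k : ℕ} (x : Fin (k + 1) → ℝ) :
    vertexSum (fun i : Fin (k + 1) => (stdSimplex.vertex i : Delta k)) x = x := by
  rw [vertexSum_apply]
  exact (pi_eq_sum_univ' x).symm

theorem affineSimplex_comp {i j k : ℕ} (w : Fin (j + 1) → Delta k) (w' : Fin (i + 1) → Delta j) :
    (affineSimplex w).comp (affineSimplex w') = affineSimplex (affineSimplex w ∘ w') :=
  ContinuousMap.ext fun x => Subtype.ext (vertexSum_vertexSum w w' x.1)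

theorem affineSimplex_vertices (k : ℕ) :
    affineSimplex (fun i : Fin (k + 1) => (stdSimplex.vertex i : Delta k)) =
      ContinuousMap.id _ :=
  ContinuousMap.ext fun x => Subtype.ext (vertexSum_vertices x.1)

/-- The map of standard simplexes induced by a map of vertices. -/
def vertexMap {j k : ℕ} (θ : Fin (j + 1) → Fin (k + 1)) : C(Delta j, Delta k) :=
  affineSimplex fun i => stdSimplex.vertex (θ i)

theorem vertexMap_vertex {j k : ℕ} (θ : Fin (j + 1) → Fin (k + 1)) (i : Fin (j + 1)) :
    vertexMap θ (stdSimplex.vertex i) = stdSimplex.vertex (θ i) :=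
  affineSimplex_vertex _ i

theorem vertexMap_eq_map {j k : ℕ} (θ : Fin (j + 1) → Fin (k + 1)) (x : Delta j) :
    vertexMap θ x = stdSimplex.map θ x := by
  refine Subtype.ext (funext fun l => ?_)
  change (vertexSum _ x.1) l = FunOnFinite.linearMap ℝ ℝ θ x.1 l
  rw [FunOnFinite.linearMap_apply_apply, vertexSum_apply, Finset.sum_apply, Finset.sum_filter]
  refine Finset.sum_congr rfl fun i _ => ?_
  simp only [Pi.smul_apply, Pi.single_apply, smul_eq_mul, mul_ite, mul_one, mul_zero]
  exact if_congr eq_comm rfl rfl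

theorem vertexMap_comp {i j k : ℕ} (θ : Fin (j + 1) → Fin (k + 1)) (η : Fin (i + 1) → Fin (j + 1)) :
    (vertexMap θ).comp (vertexMap η) = vertexMap (θ ∘ η) := by
  rw [vertexMap, vertexMap, affineSimplex_comp]
  refine congrArg affineSimplex (funext fun l => ?_)
  exact affineSimplex_vertex _ _

theorem affineSimplex_comp_vertexMap {i j k : ℕ} (w : Fin (j + 1) → Delta k)
    (η : Fin (i + 1) → Fin (j + 1)) :
    (affineSimplex w).comp (vertexMap η) = affineSimplex (w ∘ η) := by
  rw [vertexMap, affineSimplex_comp]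
  refine congrArg affineSimplex (funext fun l => ?_)
  exact affineSimplex_vertex _ _

theorem Simplex.face_eq {k : ℕ} (σ : Simplex X (k + 1)) (i : Fin (k + 2)) :
    σ.face i = σ.comp (vertexMap i.succAbove) := by
  ext x
  rw [ContinuousMap.comp_apply, vertexMap_eq_map]
  rfl

theorem vertexMap_face_face {k : ℕ} (i j : Fin (k + 2)) (h : i ≤ j) :
    (vertexMap j.succ.succAbove).comp (vertexMap i.succAbove) =
      (vertexMap i.castSucc.succAbove).comp (vertexMap j.succAbove) := by
  have := Simplex.face_face (ContinuousMap.id (Delta (k + 2))) i j h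
  rw [Simplex.face_eq, Simplex.face_eq, Simplex.face_eq, Simplex.face_eq] at this
  exact this

/-! ### Affine chains -/

/-- Integral chains of affine simplexes of dimension `j` in the standard `k`-simplex. -/
abbrev AffineChain (j k : ℕ) : Type := (Fin (j + 1) → Delta k) →₀ ℤ

/-- The boundary of affine chains. -/
def affineBoundary (j k : ℕ) : AffineChain (j + 1) k →ₗ[ℤ] AffineChain j k :=
  ∑ i : Fin (j + 2), (-1 : ℤ) ^ (i : ℕ) • Finsupp.lmapDomain ℤ ℤ fun w => w ∘ i.succAbove

/-- The inclusion of the `i`-th face on affine chains. -/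
def faceInclusion (j : ℕ) {k : ℕ} (i : Fin (k + 2)) : AffineChain j k →ₗ[ℤ] AffineChain j (k + 1) :=
  Finsupp.lmapDomain ℤ ℤ fun w => vertexMap i.succAbove ∘ w

/-- The cone with apex `b` on affine chains. -/
def affineCone {k : ℕ} (j : ℕ) (b : Delta k) : AffineChain j k →ₗ[ℤ] AffineChain (j + 1) k :=
  Finsupp.lmapDomain ℤ ℤ fun w => Fin.cons b w

/-- The sum of the coefficients. -/
def augmentation (k : ℕ) : AffineChain 0 k →ₗ[ℤ] ℤ :=
  Finsupp.linearCombination ℤ fun _ => (1 : ℤ)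

theorem affineBoundary_single {j k : ℕ} (w : Fin (j + 2) → Delta k) (z : ℤ) :
    affineBoundary j k (Finsupp.single w z) =
      ∑ i : Fin (j + 2), (-1 : ℤ) ^ (i : ℕ) • Finsupp.single (w ∘ i.succAbove) z := by
  simp only [affineBoundary, LinearMap.sum_apply, LinearMap.smul_apply, Finsupp.lmapDomain_apply,
    Finsupp.mapDomain_single]

theorem affineBoundary_faceInclusion {j k : ℕ} (i : Fin (k + 2)) (c : AffineChain (j + 1) k) :
    affineBoundary j (k + 1) (faceInclusion (j + 1) i c) =
      faceInclusion j i (affineBoundary j k c) := by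
  induction c using Finsupp.induction_linear with
  | zero => simp only [map_zero]
  | add a b ha hb => simp only [map_add, ha, hb]
  | single w z =>
    simp only [faceInclusion, Finsupp.lmapDomain_apply, Finsupp.mapDomain_single,
      affineBoundary_single, map_sum, map_smul]
    rfl

theorem cons_comp_succAbove_zero {j : ℕ} {E : Type*} (b : E) (w : Fin (j + 1) → E) :
    (Fin.cons b w : Fin (j + 2) → E) ∘ (0 : Fin (j + 2)).succAbove = w := by
  funext i
  rw [Function.comp_apply, Fin.succAbove_zero, Fin.cons_succ]

theorem cons_comp_succAbove_succ {j : ℕ} {E : Type*} (b : E) (w : Fin (j + 2) → E)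
    (i : Fin (j + 2)) :
    (Fin.cons b w : Fin (j + 3) → E) ∘ i.succ.succAbove = Fin.cons b (w ∘ i.succAbove) := by
  funext l
  refine Fin.cases ?_ (fun l => ?_) l
  · rw [Function.comp_apply, Fin.succ_succAbove_zero, Fin.cons_zero, Fin.cons_zero]
  · rw [Function.comp_apply, Fin.succ_succAbove_succ, Fin.cons_succ, Fin.cons_succ,
      Function.comp_apply]

/-- The apex is the vertex of index `0`: omitting it gives back `c`, and every other face has its
index shifted by one, hence the sign. -/
theorem affineBoundary_affineCone {j k : ℕ} (b : Delta k) (c : AffineChain (j + 1) k) :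
    affineBoundary (j + 1) k (affineCone (j + 1) b c) =
      c - affineCone j b (affineBoundary j k c) := by
  induction c using Finsupp.induction_linear with
  | zero => simp only [map_zero, sub_zero]
  | add a a' ha hb => simp only [map_add, ha, hb]; abel
  | single w z =>
    simp only [affineCone, Finsupp.lmapDomain_apply, Finsupp.mapDomain_single,
      affineBoundary_single, map_sum, map_smul]
    rw [Fin.sum_univ_succ, cons_comp_succAbove_zero, Fin.val_zero, pow_zero, one_smul, sub_eq_add_neg,
      ← Finset.sum_neg_distrib]
    refine congrArg _ (Finset.sum_congr rfl fun i _ => ?_)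
    rw [cons_comp_succAbove_succ, Fin.val_succ, pow_succ, mul_neg_one, neg_smul]

theorem affineBoundary_affineCone_zero {k : ℕ} (b : Delta k) (c : AffineChain 0 k) :
    affineBoundary 0 k (affineCone 0 b c) =
      c - augmentation k c • Finsupp.single (fun _ => b) 1 := by
  induction c using Finsupp.induction_linear with
  | zero => simp only [map_zero, zero_smul, sub_zero]
  | add a a' ha hb => simp only [map_add, ha, hb, add_smul]; abel
  | single w z =>
    simp only [affineCone, Finsupp.lmapDomain_apply, Finsupp.mapDomain_single,
      affineBoundary_single, augmentation, Finsupp.linearCombination_single]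
    rw [Fin.sum_univ_two, cons_comp_succAbove_zero]
    have : (Fin.cons b w : Fin 2 → Delta k) ∘ (1 : Fin 2).succAbove = fun _ => b := by
      funext l
      rw [Subsingleton.elim l 0]
      rfl
    rw [this]
    simp [sub_eq_add_neg]

theorem augmentation_faceInclusion {k : ℕ} (i : Fin (k + 2)) (c : AffineChain 0 k) :
    augmentation (k + 1) (faceInclusion 0 i c) = augmentation k c := by
  rw [augmentation, faceInclusion, Finsupp.lmapDomain_apply, Finsupp.linearCombination_mapDomain]
  rfl

/-! ### Families of affine chains indexed by the singular simplexes -/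

/-- An affine chain of dimension `j` in the source of each singular `k`-simplex of `X`. -/
abbrev AffineFamily (X : Type u) [TopologicalSpace X] (k j : ℕ) : Type u :=
  Simplex X k → AffineChain j k

/-- The family `σ ↦ ∑ (-1)^i a(∂_i σ)`. -/
def faceSum (X : Type u) [TopologicalSpace X] (k j : ℕ) :
    AffineFamily X k j →ₗ[ℤ] AffineFamily X (k + 1) j :=
  LinearMap.pi fun σ => ∑ i : Fin (k + 2),
    (-1 : ℤ) ^ (i : ℕ) • (faceInclusion j i ∘ₗ LinearMap.proj (σ.face i))

theorem faceSum_apply {k j : ℕ} (a : AffineFamily X k j) (σ : Simplex X (k + 1)) :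
    faceSum X k j a σ = ∑ i : Fin (k + 2), (-1 : ℤ) ^ (i : ℕ) • faceInclusion j i (a (σ.face i)) := by
  simp [faceSum]

theorem affineBoundary_faceSum {k j : ℕ} (a : AffineFamily X k (j + 1)) (σ : Simplex X (k + 1)) :
    affineBoundary j (k + 1) (faceSum X k (j + 1) a σ) =
      faceSum X k j (fun τ => affineBoundary j k (a τ)) σ := by
  simp only [faceSum_apply, map_sum, map_smul, affineBoundary_faceInclusion]

theorem faceInclusion_faceInclusion {k l : ℕ} (i j : Fin (k + 2)) (h : i ≤ j)
    (c : AffineChain l k) :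
    faceInclusion l j.succ (faceInclusion l i c) =
      faceInclusion l i.castSucc (faceInclusion l j c) := by
  simp only [faceInclusion, Finsupp.lmapDomain_apply, ← Finsupp.mapDomain_comp]
  refine congrArg (fun f => Finsupp.mapDomain f c) (funext fun w => funext fun m => ?_)
  exact congrArg (fun f : C(Delta k, Delta (k + 2)) => f (w m)) (vertexMap_face_face i j h)

/-- This is `∂∂ = 0` for the source simplexes, transposed to families; the terms cancel in pairs by
the relation between iterated faces. -/
theorem faceSum_faceSum {k l : ℕ} (a : AffineFamily X k l) :
    faceSum X (k + 1) l (faceSum X k l a) = 0 := by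
  funext σ
  simp only [faceSum_apply, map_sum, map_smul, Finset.smul_sum, smul_smul, Pi.zero_apply]
  rw [← Finset.sum_product', ← Finset.sum_filter_add_sum_filter_not _
    (fun ij : Fin (k + 3) × Fin (k + 2) => (ij.1 : ℕ) ≤ (ij.2 : ℕ)), ← eq_neg_iff_add_eq_zero,
    ← Finset.sum_neg_distrib]
  refine Finset.sum_bij'
    (fun ij h => (ij.2.succ, Fin.castLT ij.1
      (lt_of_le_of_lt (Finset.mem_filter.1 h).2 ij.2.isLt)))
    (fun ij h => (ij.2.castSucc, ij.1.pred (by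
      intro h0
      have := (Finset.mem_filter.1 h).2
      simp [h0] at this)))
    ?_ ?_ ?_ ?_ ?_
  · rintro ⟨i, j⟩ h
    simp only [Finset.mem_filter, Finset.mem_product, Finset.mem_univ, true_and, and_self] at h ⊢
    simp
    omega
  · rintro ⟨i, j⟩ h
    simp only [Finset.mem_filter, Finset.mem_product, Finset.mem_univ, true_and, and_self] at h ⊢
    simp
    omega
  · rintro ⟨i, j⟩ h
    simp
  · rintro ⟨i, j⟩ h
    simp
  · rintro ⟨i, j⟩ h
    have hij : (i : ℕ) ≤ (j : ℕ) := (Finset.mem_filter.1 h).2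
    have hlt : (i : ℕ) < k + 2 := lt_of_le_of_lt hij j.isLt
    have h1 := Simplex.face_face σ (Fin.castLT i hlt) j hij
    have h2 := faceInclusion_faceInclusion (l := l) (Fin.castLT i hlt) j hij
    simp only [Fin.castSucc_castLT] at h1 h2
    simp only [h1, h2, Fin.val_succ, Fin.val_castLT, ← neg_smul]
    congr 1
    ring

/-! ### The operators on singular chains given by families of affine chains -/

section realize

variable (R : Type v) [CommRing R] (G : Type w) [AddCommGroup G] [Module R G]

/-- The push-forward of affine chains along a singular simplex. -/
def pushforward (j : ℕ) {k : ℕ} (σ : Simplex X k) : AffineChain j k →ₗ[ℤ] (G →ₗ[R] Chain X G j) :=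
  Finsupp.linearCombination ℤ fun w => Finsupp.lsingle (σ.comp (affineSimplex w) : Simplex X j)

/-- The operator on singular chains given by a family of affine chains. -/
def realize {j k : ℕ} (a : AffineFamily X k j) : Chain X G k →ₗ[R] Chain X G j :=
  Finsupp.lsum ℕ fun σ => pushforward R G j σ (a σ)

theorem pushforward_single {j k : ℕ} (σ : Simplex X k) (w : Fin (j + 1) → Delta k) (z : ℤ) (g : G) :
    pushforward R G j σ (Finsupp.single w z) g =
      z • Finsupp.single (σ.comp (affineSimplex w) : Simplex X j) g := by
  simp [pushforward]

theorem realize_single {j k : ℕ} (a : AffineFamily X k j) (σ : Simplex X k) (g : G) :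
    realize R G a (Finsupp.single σ g) = pushforward R G j σ (a σ) g := by
  simp [realize]

theorem boundary_single {k : ℕ} (σ : Simplex X (k + 1)) (g : G) :
    boundary R G X k (Finsupp.single σ g) =
      ∑ i : Fin (k + 2), (-1 : R) ^ (i : ℕ) • Finsupp.single (σ.face i) g := by
  simp only [boundary, LinearMap.sum_apply, LinearMap.smul_apply, Finsupp.lmapDomain_apply,
    Finsupp.mapDomain_single]

theorem neg_one_pow_smul_eq {M : Type*} [AddCommGroup M] [Module R M] (i : ℕ) (m : M) :
    (-1 : R) ^ i • m = (-1 : ℤ) ^ i • m := by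
  rcases neg_one_pow_eq_or ℤ i with h | h
  · have h' : (-1 : R) ^ i = 1 := by have := congrArg (Int.cast : ℤ → R) h; simpa using this
    rw [h, h', one_smul, one_smul]
  · have h' : (-1 : R) ^ i = -1 := by have := congrArg (Int.cast : ℤ → R) h; simpa using this
    rw [h, h', neg_one_smul, neg_one_smul]

theorem boundary_pushforward {j k : ℕ} (σ : Simplex X k) (c : AffineChain (j + 1) k) (g : G) :
    boundary R G X j (pushforward R G (j + 1) σ c g) =
      pushforward R G j σ (affineBoundary j k c) g := by
  induction c using Finsupp.induction_linear with
  | zero => simp only [map_zero, LinearMap.zero_apply]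
  | add a b ha hb => simp only [map_add, LinearMap.add_apply, ha, hb]
  | single w z =>
    simp only [pushforward_single, affineBoundary_single, map_sum, map_zsmul, boundary_single,
      LinearMap.sum_apply, LinearMap.smul_apply, Finset.smul_sum]
    refine Finset.sum_congr rfl fun i _ => ?_
    rw [neg_one_pow_smul_eq, Simplex.face_eq, ContinuousMap.comp_assoc,
      affineSimplex_comp_vertexMap, smul_comm]

theorem pushforward_face {j k : ℕ} (σ : Simplex X (k + 1)) (i : Fin (k + 2)) (c : AffineChain j k)
    (g : G) :
    pushforward R G j (σ.face i) c g = pushforward R G j σ (faceInclusion j i c) g := by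
  induction c using Finsupp.induction_linear with
  | zero => simp only [map_zero]
  | add a b ha hb => simp only [map_add, LinearMap.add_apply, ha, hb]
  | single w z =>
    simp only [pushforward_single, faceInclusion, Finsupp.lmapDomain_apply,
      Finsupp.mapDomain_single]
    rw [Simplex.face_eq, ContinuousMap.comp_assoc, vertexMap, affineSimplex_comp]

theorem boundary_realize {j k : ℕ} (a : AffineFamily X k (j + 1)) (ξ : Chain X G k) :
    boundary R G X j (realize R G a ξ) = realize R G (fun σ => affineBoundary j k (a σ)) ξ := by
  induction ξ using Finsupp.induction_linear with
  | zero => simp only [map_zero]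
  | add a b ha hb => simp only [map_add, ha, hb]
  | single σ g => rw [realize_single, realize_single, boundary_pushforward]

/-- A face of `σ` followed by an affine simplex is an affine simplex in the source of `σ`. With
`boundary_realize`, identities between operators on chains in `G` reduce to identities between
families of integral affine chains. -/
theorem realize_boundary {j k : ℕ} (a : AffineFamily X k j) (ξ : Chain X G (k + 1)) :
    realize R G a (boundary R G X k ξ) = realize R G (faceSum X k j a) ξ := by
  induction ξ using Finsupp.induction_linear with
  | zero => simp only [map_zero]
  | add a b ha hb => simp only [map_add, ha, hb]
  | single σ g =>
    rw [realize_single, boundary_single, map_sum, faceSum_apply, map_sum, LinearMap.sum_apply]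
    refine Finset.sum_congr rfl fun i _ => ?_
    rw [map_smul, realize_single, pushforward_face, neg_one_pow_smul_eq, map_smul,
      LinearMap.smul_apply]

theorem realize_add {j k : ℕ} (a b : AffineFamily X k j) (ξ : Chain X G k) :
    realize R G (a + b) ξ = realize R G a ξ + realize R G b ξ := by
  induction ξ using Finsupp.induction_linear with
  | zero => simp only [map_zero, add_zero]
  | add c d hc hd => simp only [map_add, hc, hd]; abel
  | single σ g =>
    rw [realize_single, realize_single, realize_single, Pi.add_apply, map_add, LinearMap.add_apply]

theorem realize_sub {j k : ℕ} (a b : AffineFamily X k j) (ξ : Chain X G k) :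
    realize R G (a - b) ξ = realize R G a ξ - realize R G b ξ := by
  rw [eq_sub_iff_add_eq, ← realize_add, sub_add_cancel]

/-- Cancellation can only shrink the support, so allowability and containment may be checked one
simplex at a time. -/
theorem exists_of_mem_support_realize {j k : ℕ} {a : AffineFamily X k j} {ξ : Chain X G k}
    {τ : Simplex X j} (h : τ ∈ (realize R G a ξ).support) :
    ∃ σ ∈ ξ.support, ∃ w ∈ (a σ).support, τ = σ.comp (affineSimplex w) := by
  classical
  rw [realize, Finsupp.lsum_apply] at h
  obtain ⟨σ, hσ, h⟩ := Finset.mem_biUnion.1 (Finsupp.support_finsetSum h)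
  refine ⟨σ, hσ, ?_⟩
  dsimp only at h
  rw [pushforward, Finsupp.linearCombination_apply, Finsupp.sum, LinearMap.sum_apply] at h
  obtain ⟨w, hw, h⟩ := Finset.mem_biUnion.1 (Finsupp.support_finsetSum h)
  refine ⟨w, hw, ?_⟩
  have h2 := Finsupp.support_smul h
  exact Finset.mem_singleton.1 (Finsupp.support_single_subset h2)

end realize

/-! ### Subdivision with chosen interior points -/

/-- The affine chain given by the identity of the standard simplex. -/
def identityFamily (X : Type u) [TopologicalSpace X] (k : ℕ) : AffineFamily X k k :=
  fun _ => Finsupp.single (fun i => stdSimplex.vertex i) 1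

/-- A point in the source of each singular simplex. -/
abbrev PointChoice (X : Type u) [TopologicalSpace X] : Type u := ∀ k, Simplex X k → Delta k

open Classical in
/-- The part of the subdivision of a singular simplex that consists of the simplexes whose last
vertex, a vertex of the given simplex, is sent into `L`. -/
def subdivision (b : PointChoice X) (L : Set X) : ∀ k, AffineFamily X k k
  | 0 => fun σ => if σ (stdSimplex.vertex 0) ∈ L then identityFamily X 0 σ else 0
  | k + 1 => fun σ => affineCone k (b (k + 1) σ) (faceSum X k k (subdivision b L k) σ)

/-- The chain homotopy from the identity to the subdivision. -/
def subdivisionHomotopy (b : PointChoice X) : ∀ k, AffineFamily X k (k + 1)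
  | 0 => 0
  | k + 1 => fun σ => affineCone (k + 1) (b (k + 1) σ)
      ((identityFamily X (k + 1) - faceSum X k (k + 1) (subdivisionHomotopy b k)) σ)

/-- The failure of the partial subdivision to be a chain map. -/
def dualBoundary (b : PointChoice X) (L : Set X) : ∀ k, AffineFamily X (k + 1) k
  | 0 => fun σ => augmentation 1 (faceSum X 0 0 (subdivision b L 0) σ) •
      Finsupp.single (fun _ : Fin 1 => b 1 σ) (1 : ℤ)
  | k + 1 => fun σ => -affineCone k (b (k + 2) σ) (faceSum X (k + 1) k (dualBoundary b L k) σ)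

open Classical in
theorem subdivision_zero (b : PointChoice X) (L : Set X) (σ : Simplex X 0) :
    subdivision b L 0 σ = if σ (stdSimplex.vertex 0) ∈ L then identityFamily X 0 σ else 0 := by
  rw [subdivision]

theorem subdivision_succ (b : PointChoice X) (L : Set X) (k : ℕ) (σ : Simplex X (k + 1)) :
    subdivision b L (k + 1) σ =
      affineCone k (b (k + 1) σ) (faceSum X k k (subdivision b L k) σ) := rfl

theorem dualBoundary_zero (b : PointChoice X) (L : Set X) (σ : Simplex X 1) :
    dualBoundary b L 0 σ = augmentation 1 (faceSum X 0 0 (subdivision b L 0) σ) •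
      Finsupp.single (fun _ : Fin 1 => b 1 σ) (1 : ℤ) := rfl

theorem dualBoundary_succ (b : PointChoice X) (L : Set X) (k : ℕ) (σ : Simplex X (k + 2)) :
    dualBoundary b L (k + 1) σ =
      -affineCone k (b (k + 2) σ) (faceSum X (k + 1) k (dualBoundary b L k) σ) := rfl

/-- The cone formula gives the subdivision of the faces, together with the cone over the error one
dimension lower. The error starts in dimension one: coning off the labelled end points of an edge
leaves a multiple of its chosen point. -/
theorem affineBoundary_subdivision (b : PointChoice X) (L : Set X) (k : ℕ) :
    (fun σ => affineBoundary k (k + 1) (subdivision b L (k + 1) σ)) =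
      faceSum X k k (subdivision b L k) - dualBoundary b L k := by
  induction k with
  | zero =>
    funext σ
    rw [Pi.sub_apply, dualBoundary_zero, ← affineBoundary_affineCone_zero]
    rfl
  | succ k ih =>
    funext σ
    rw [subdivision_succ, affineBoundary_affineCone, affineBoundary_faceSum, ih, map_sub,
      faceSum_faceSum, zero_sub, Pi.neg_apply, map_neg, Pi.sub_apply, dualBoundary_succ]

/-- With all vertices kept, the end points of an edge have total coefficient zero, so the error
never starts and the full subdivision is a chain map. -/
theorem dualBoundary_univ (b : PointChoice X) (k : ℕ) : dualBoundary b Set.univ k = 0 := by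
  induction k with
  | zero =>
    funext σ
    have : augmentation 1 (faceSum X 0 0 (subdivision b Set.univ 0) σ) = 0 := by
      simp only [faceSum_apply, map_sum, map_smul, augmentation_faceInclusion, subdivision_zero,
        Set.mem_univ, if_true, identityFamily]
      simp [augmentation, Fin.sum_univ_two]
    rw [dualBoundary_zero, this, zero_smul]
    rfl
  | succ k ih =>
    funext σ
    rw [dualBoundary_succ, ih, map_zero, Pi.zero_apply, map_zero, neg_zero]
    rfl

theorem affineBoundary_subdivision_univ (b : PointChoice X) (k : ℕ) :
    (fun σ => affineBoundary k (k + 1) (subdivision b Set.univ (k + 1) σ)) =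
      faceSum X k k (subdivision b Set.univ k) := by
  rw [affineBoundary_subdivision, dualBoundary_univ, sub_zero]

/-- Each vertex has exactly one of the two labels, and the recursion is linear. -/
theorem subdivision_add_compl (b : PointChoice X) (L : Set X) (k : ℕ) :
    subdivision b L k + subdivision b Lᶜ k = subdivision b Set.univ k := by
  induction k with
  | zero =>
    funext σ
    by_cases h : σ (stdSimplex.vertex 0) ∈ L <;> simp [subdivision_zero, h]
  | succ k ih =>
    funext σ
    rw [Pi.add_apply, subdivision_succ, subdivision_succ, subdivision_succ, ← map_add,
      ← Pi.add_apply, ← map_add, ih]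

theorem affineBoundary_identityFamily (k : ℕ) :
    (fun σ => affineBoundary k (k + 1) (identityFamily X (k + 1) σ)) =
      faceSum X k k (identityFamily X k) := by
  funext σ
  rw [faceSum_apply, identityFamily, affineBoundary_single]
  refine Finset.sum_congr rfl fun i _ => ?_
  rw [identityFamily, faceInclusion, Finsupp.lmapDomain_apply, Finsupp.mapDomain_single]
  refine congrArg (fun w => (-1 : ℤ) ^ (i : ℕ) • Finsupp.single w (1 : ℤ)) (funext fun l => ?_)
  exact (vertexMap_vertex _ _).symm

/-- The usual construction: cone off `id - T∂`, whose boundary is, by induction, the subdivision of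
the faces. -/
theorem affineBoundary_subdivisionHomotopy (b : PointChoice X) (k : ℕ) :
    (fun σ => affineBoundary (k + 1) (k + 1) (subdivisionHomotopy b (k + 1) σ)) +
        faceSum X k (k + 1) (subdivisionHomotopy b k) =
      identityFamily X (k + 1) - subdivision b Set.univ (k + 1) := by
  -- The induction starts in degree `0`, where the term coming from faces is absent; the `match`
  -- treats both cases in one statement.
  have key : ∀ k, (fun σ => affineBoundary k k (subdivisionHomotopy b k σ)) =
      identityFamily X k - subdivision b Set.univ k -
        (match k with
        | 0 => 0
        | k + 1 => faceSum X k (k + 1) (subdivisionHomotopy b k)) := by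
    intro k
    induction k with
    | zero =>
      funext σ
      simp [subdivisionHomotopy, subdivision_zero]
    | succ k ih =>
      have hz : faceSum X k k (fun σ => affineBoundary k k (subdivisionHomotopy b k σ)) =
          faceSum X k k (identityFamily X k) - faceSum X k k (subdivision b Set.univ k) := by
        rw [ih, map_sub, map_sub]
        cases k with
        | zero => simp
        | succ k => simp only [faceSum_faceSum, sub_zero]
      funext σ
      have hid := congrFun (affineBoundary_identityFamily (X := X) k) σ
      rw [subdivisionHomotopy, affineBoundary_affineCone, Pi.sub_apply, map_sub,
        affineBoundary_faceSum, hz, hid, Pi.sub_apply, sub_sub_cancel]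
      rw [Pi.sub_apply, Pi.sub_apply, subdivision_succ]
      abel
  rw [key (k + 1)]
  simp

section realize

variable (R : Type v) [CommRing R] (G : Type w) [AddCommGroup G] [Module R G]

theorem realize_identityFamily (k : ℕ) (ξ : Chain X G k) :
    realize R G (identityFamily X k) ξ = ξ := by
  induction ξ using Finsupp.induction_linear with
  | zero => simp only [map_zero]
  | add a b ha hb => simp only [map_add, ha, hb]
  | single σ g =>
    rw [realize_single, identityFamily, pushforward_single, affineSimplex_vertices, one_smul]
    rfl

theorem boundary_subdivision (b : PointChoice X) (L : Set X) (k : ℕ) (ξ : Chain X G (k + 1)) :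
    boundary R G X k (realize R G (subdivision b L (k + 1)) ξ) =
      realize R G (subdivision b L k) (boundary R G X k ξ) -
        realize R G (dualBoundary b L k) ξ := by
  rw [boundary_realize, affineBoundary_subdivision, realize_sub, realize_boundary]

theorem boundary_subdivision_univ (b : PointChoice X) (k : ℕ) (ξ : Chain X G (k + 1)) :
    boundary R G X k (realize R G (subdivision b Set.univ (k + 1)) ξ) =
      realize R G (subdivision b Set.univ k) (boundary R G X k ξ) := by
  rw [boundary_realize, affineBoundary_subdivision_univ, realize_boundary]

theorem boundary_subdivisionHomotopy (b : PointChoice X) (k : ℕ) (ξ : Chain X G (k + 1)) :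
    boundary R G X (k + 1) (realize R G (subdivisionHomotopy b (k + 1)) ξ) =
      ξ - realize R G (subdivision b Set.univ (k + 1)) ξ -
        realize R G (subdivisionHomotopy b k) (boundary R G X k ξ) := by
  rw [boundary_realize, realize_boundary, eq_sub_iff_add_eq, ← realize_add,
    affineBoundary_subdivisionHomotopy, realize_sub, realize_identityFamily]

theorem realize_subdivision_univ_zero (b : PointChoice X) (ξ : Chain X G 0) :
    realize R G (subdivision b Set.univ 0) ξ = ξ := by
  have : subdivision b Set.univ 0 = identityFamily X 0 := by
    funext σ
    simp [subdivision_zero]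
  rw [this, realize_identityFamily]

end realize

/-! ### The simplexes of the subdivision -/

/-- The vertices of the dual simplexes in the standard simplex, the source of `σ`: the points
chosen for a full flag of faces of positive dimension, in decreasing order. -/
def dualFlags (b : PointChoice X) : ∀ k, Simplex X k → Set (Fin k → Delta k)
  | 0 => fun _ => Set.univ
  | k + 1 => fun σ => {w | ∃ i, ∃ w' ∈ dualFlags b k (σ.face i),
      w = Fin.cons (b (k + 1) σ) (vertexMap i.succAbove ∘ w')}

theorem finite_dualFlags (b : PointChoice X) (k : ℕ) (σ : Simplex X k) :
    (dualFlags b k σ).Finite := by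
  induction k with
  | zero => exact Set.toFinite _
  | succ k ih =>
    refine (Set.finite_iUnion fun i => (ih (σ.face i)).image fun w' =>
      (Fin.cons (b (k + 1) σ) (vertexMap i.succAbove ∘ w') : Fin (k + 1) → Delta (k + 1))).subset ?_
    rintro _ ⟨i, w', hw', rfl⟩
    exact Set.mem_iUnion.2 ⟨i, w', hw', rfl⟩

theorem exists_of_mem_support_faceSum {k j : ℕ} {a : AffineFamily X k j} {σ : Simplex X (k + 1)}
    {w : Fin (j + 1) → Delta (k + 1)} (h : w ∈ (faceSum X k j a σ).support) :
    ∃ i, ∃ w' ∈ (a (σ.face i)).support, w = vertexMap i.succAbove ∘ w' := by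
  classical
  rw [faceSum_apply] at h
  obtain ⟨i, -, h⟩ := Finset.mem_biUnion.1 (Finsupp.support_finsetSum h)
  have h2 := Finsupp.mapDomain_support (Finsupp.support_smul h)
  obtain ⟨w', hw', rfl⟩ := Finset.mem_image.1 h2
  exact ⟨i, w', hw', rfl⟩

theorem exists_of_mem_support_affineCone {k j : ℕ} {b : Delta k} {c : AffineChain j k}
    {w : Fin (j + 2) → Delta k} (h : w ∈ (affineCone j b c).support) :
    ∃ w' ∈ c.support, w = Fin.cons b w' := by
  classical
  obtain ⟨w', hw', rfl⟩ := Finset.mem_image.1 (Finsupp.mapDomain_support h)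
  exact ⟨w', hw', rfl⟩

theorem exists_of_mem_support_subdivision {b : PointChoice X} {L : Set X} {k : ℕ}
    {σ : Simplex X (k + 1)} {w : Fin (k + 2) → Delta (k + 1)}
    (h : w ∈ (subdivision b L (k + 1) σ).support) :
    ∃ i, ∃ w' ∈ (subdivision b L k (σ.face i)).support,
      w = Fin.cons (b (k + 1) σ) (vertexMap i.succAbove ∘ w') := by
  obtain ⟨w₁, hw₁, rfl⟩ := exists_of_mem_support_affineCone h
  obtain ⟨i, w', hw', rfl⟩ := exists_of_mem_support_faceSum hw₁
  exact ⟨i, w', hw', rfl⟩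

/-- Only chosen points of faces of positive dimension occur, never original vertices. All vertices
of a dual simplex are therefore at free disposal. -/
theorem mem_dualFlags_of_mem_support {b : PointChoice X} {L : Set X} {k : ℕ}
    {σ : Simplex X (k + 1)} {w : Fin (k + 1) → Delta (k + 1)}
    (h : w ∈ (dualBoundary b L k σ).support) : w ∈ dualFlags b (k + 1) σ := by
  classical
  induction k with
  | zero =>
    rw [dualBoundary_zero] at h
    have h2 := Finset.mem_singleton.1 (Finsupp.support_single_subset (Finsupp.support_smul h))
    refine ⟨0, Fin.elim0, trivial, h2.trans (funext fun l => ?_)⟩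
    rw [Subsingleton.elim l 0]
    rfl
  | succ k ih =>
    rw [dualBoundary_succ, Finsupp.support_neg] at h
    obtain ⟨w₁, hw₁, rfl⟩ := exists_of_mem_support_affineCone h
    obtain ⟨i, w', hw', rfl⟩ := exists_of_mem_support_faceSum hw₁
    exact ⟨i, w', ih hw', rfl⟩

/-- The point is the vertex of `σ` at which the flag ends. -/
theorem exists_mem_of_mem_support_subdivision {b : PointChoice X} {L : Set X} {k : ℕ}
    {σ : Simplex X k} {w : Fin (k + 1) → Delta k} (h : w ∈ (subdivision b L k σ).support) :
    ∃ x, σ x ∈ L := by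
  induction k with
  | zero =>
    rw [subdivision_zero] at h
    split_ifs at h with hL
    · exact ⟨_, hL⟩
    · simp at h
  | succ k ih =>
    obtain ⟨i, w', hw', -⟩ := exists_of_mem_support_subdivision h
    obtain ⟨x, hx⟩ := ih hw'
    rw [Simplex.face_eq] at hx
    exact ⟨_, hx⟩

/-- The linear extension of the inclusion of a face. -/
def faceLin {k : ℕ} (i : Fin (k + 2)) : (Fin (k + 1) → ℝ) →ₗ[ℝ] (Fin (k + 2) → ℝ) :=
  vertexSum fun l => stdSimplex.vertex (i.succAbove l)

theorem faceLin_apply_self {k : ℕ} (i : Fin (k + 2)) (x : Fin (k + 1) → ℝ) :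
    faceLin i x i = 0 := by
  simp [faceLin, vertexSum_apply, Finset.sum_apply]

theorem faceLin_apply_succAbove {k : ℕ} (i : Fin (k + 2)) (x : Fin (k + 1) → ℝ) (l : Fin (k + 1)) :
    faceLin i x (i.succAbove l) = x l := by
  simp [faceLin, vertexSum_apply, Finset.sum_apply, Pi.single_apply]

theorem faceLin_injective {k : ℕ} (i : Fin (k + 2)) : Function.Injective (faceLin i) := by
  intro x y h
  funext l
  rw [← faceLin_apply_succAbove i x, h, faceLin_apply_succAbove]

theorem mem_range_faceLin {k : ℕ} (i : Fin (k + 2)) (x : Fin (k + 2) → ℝ) (h : x i = 0) :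
    ∃ y, faceLin i y = x := by
  refine ⟨fun l => x (i.succAbove l), funext fun m => ?_⟩
  rcases Fin.eq_self_or_eq_succAbove i m with rfl | ⟨l, rfl⟩
  · rw [faceLin_apply_self, h]
  · rw [faceLin_apply_succAbove]

/-- All chosen points have positive coordinates. -/
def PointChoice.IsInterior (b : PointChoice X) : Prop := ∀ k σ i, 0 < (b k σ).1 i

theorem coe_cons_comp_vertexMap {j k : ℕ} (b : Delta (k + 1)) (i : Fin (k + 2))
    (w : Fin j → Delta k) :
    (fun l => ((Fin.cons b (vertexMap i.succAbove ∘ w) : Fin (j + 1) → Delta (k + 1)) l).1) =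
      Fin.cons b.1 (faceLin i ∘ fun l => (w l).1) := by
  funext l
  refine Fin.cases ?_ (fun l => ?_) l <;> rfl

/-- The `i`-th coordinate vanishes on the `i`-th face and is positive at the apex. -/
theorem linearIndependent_cons {j k : ℕ} {b : Delta (k + 1)} (hb : ∀ i, 0 < b.1 i)
    (i : Fin (k + 2)) {w : Fin j → Delta k} (hw : LinearIndependent ℝ fun l => (w l).1) :
    LinearIndependent ℝ
      fun l => ((Fin.cons b (vertexMap i.succAbove ∘ w) : Fin (j + 1) → Delta (k + 1)) l).1 := by
  rw [coe_cons_comp_vertexMap, linearIndependent_finCons]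
  refine ⟨hw.map' _ (LinearMap.ker_eq_bot.2 (faceLin_injective i)), fun h => ?_⟩
  have h1 : Submodule.span ℝ (Set.range (faceLin i ∘ fun l => (w l).1)) ≤
      LinearMap.ker (LinearMap.proj i : (Fin (k + 2) → ℝ) →ₗ[ℝ] ℝ) := by
    rw [Submodule.span_le]
    rintro _ ⟨l, rfl⟩
    exact faceLin_apply_self i _
  exact (hb i).ne' (h1 h)

theorem delta_coe_ne_zero {k : ℕ} (x : Delta k) : x.1 ≠ 0 := by
  intro h
  have h1 := x.2.2
  rw [h] at h1
  simp at h1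

theorem linearIndependent_of_mem_subdivision {b : PointChoice X} (hb : b.IsInterior) {L : Set X}
    {k : ℕ} {σ : Simplex X k} {w : Fin (k + 1) → Delta k}
    (h : w ∈ (subdivision b L k σ).support) : LinearIndependent ℝ fun l => (w l).1 := by
  induction k with
  | zero =>
    have : Unique (Fin (0 + 1)) := inferInstanceAs (Unique (Fin 1))
    exact linearIndependent_unique_iff.2 (delta_coe_ne_zero _)
  | succ k ih =>
    obtain ⟨i, w', hw', rfl⟩ := exists_of_mem_support_subdivision h
    exact linearIndependent_cons (hb _ _) i (ih hw')

theorem linearIndependent_of_mem_dualFlags {b : PointChoice X} (hb : b.IsInterior)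
    {k : ℕ} {σ : Simplex X k} {w : Fin k → Delta k}
    (h : w ∈ dualFlags b k σ) : LinearIndependent ℝ fun l => (w l).1 := by
  induction k with
  | zero => exact linearIndependent_empty_type
  | succ k ih =>
    obtain ⟨i, w', hw', rfl⟩ := h
    exact linearIndependent_cons (hb _ _) i (ih hw')

/-- Each simplex of the homotopy is a cone over the whole simplex, or a cone with interior apex over
a simplex that spans a face. -/
theorem span_eq_top_of_mem_subdivisionHomotopy {b : PointChoice X} (hb : b.IsInterior)
    {k : ℕ} {σ : Simplex X k} {w : Fin (k + 2) → Delta k}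
    (h : w ∈ (subdivisionHomotopy b k σ).support) :
    Submodule.span ℝ (Set.range fun l => (w l).1) = ⊤ := by
  classical
  induction k with
  | zero => simp [subdivisionHomotopy] at h
  | succ k ih =>
    obtain ⟨w₁, hw₁, rfl⟩ := exists_of_mem_support_affineCone h
    rw [Pi.sub_apply] at hw₁
    rcases Finset.mem_union.1 (Finsupp.support_sub hw₁) with h1 | h1
    · have h2 := Finset.mem_singleton.1 (Finsupp.support_single_subset h1)
      rw [eq_top_iff, ← (Pi.basisFun ℝ (Fin (k + 2))).span_eq]
      refine Submodule.span_mono ?_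
      rintro _ ⟨i, rfl⟩
      refine ⟨i.succ, ?_⟩
      simp only [h2, Fin.cons_succ, Pi.basisFun_apply]
    · obtain ⟨i, w', hw', rfl⟩ := exists_of_mem_support_faceSum h1
      have hs := ih hw'
      rw [coe_cons_comp_vertexMap, Fin.range_cons, Set.range_comp, eq_top_iff]
      intro x _
      rw [Submodule.mem_span_insert]
      -- Subtract the multiple of the apex that cancels the `i`-th coordinate; the rest lies in the
      -- space of the `i`-th face.
      obtain ⟨y, hy⟩ := mem_range_faceLin i
        (x - (x i / (b (k + 1) σ).1 i) • (b (k + 1) σ).1) (by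
          rw [Pi.sub_apply, Pi.smul_apply, smul_eq_mul, div_mul_cancel₀ _ (hb _ _ _).ne', sub_self])
      refine ⟨_, faceLin i y, ?_, (by rw [hy, add_sub_cancel])⟩
      rw [← Submodule.map_span, hs]
      exact ⟨y, trivial, rfl⟩

/-! ### Allowability of the simplexes of the subdivision -/

theorem finrank_comap_eq {V V' : Type*} [AddCommGroup V] [Module ℝ V] [AddCommGroup V']
    [Module ℝ V'] [FiniteDimensional ℝ V] (A : V →ₗ[ℝ] V') (W : Submodule ℝ V') :
    Module.finrank ℝ (W.comap A) =
      Module.finrank ℝ (LinearMap.range A ⊓ W : Submodule ℝ V') +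
        Module.finrank ℝ (LinearMap.ker A) := by
  have h := LinearMap.finrank_range_add_finrank_ker (A.domRestrict (W.comap A))
  rw [LinearMap.range_domRestrict, Submodule.map_comap_eq] at h
  have h2 : Submodule.map (W.comap A).subtype (LinearMap.ker (A.domRestrict (W.comap A))) =
      LinearMap.ker A := by
    ext x
    constructor
    · rintro ⟨y, hy, rfl⟩
      exact hy
    · intro hx
      have hx' : x ∈ W.comap A := by
        rw [Submodule.mem_comap, LinearMap.mem_ker.1 hx]
        exact W.zero_mem
      exact ⟨⟨x, hx'⟩, hx, rfl⟩
  rw [← h, ← Submodule.finrank_map_subtype_eq (W.comap A), h2]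

theorem Simplex.preimage_subset {k : ℕ} (σ : Simplex X k) (A : Set X) :
    σ.preimage A ⊆ Delta k := by
  rintro _ ⟨x, -, rfl⟩
  exact x.2

/-- Pull the covering subspaces back along the affine simplex. The condition `hw` says that the
dimension relative to that of the source simplex does not increase. -/
theorem polyDimLE_preimage_comp {j k : ℕ} {σ : Simplex X k} {w : Fin (j + 1) → Delta k} {A : Set X}
    {T : Set (Submodule ℝ (Fin (k + 1) → ℝ))} (hfin : T.Finite) {c : ℤ} {q : ExtInt}
    (hT : ∀ W ∈ T, ofInt ((Module.finrank ℝ W : ℤ) - 1) ≤ ofInt ((k : ℤ) - c) + q)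
    (hA : ∀ x ∈ σ.preimage A, ∃ W ∈ T, x ∈ W)
    (hw : ∀ W ∈ T, Module.finrank ℝ (W.comap (vertexSum w)) + k ≤ Module.finrank ℝ W + j) :
    PolyDimLE (Simplex.preimage (σ.comp (affineSimplex w)) A) (ofInt ((j : ℤ) - c) + q) := by
  rw [polyDimLE_iff (Simplex.preimage_subset _ _)]
  refine ⟨{W' | W' ≠ ⊥ ∧ ∃ W ∈ T, W' = W.comap (vertexSum w)},
    (hfin.image fun W => W.comap (vertexSum w)).subset ?_, ?_, ?_⟩
  · rintro _ ⟨-, W, hW, rfl⟩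
    exact ⟨W, hW, rfl⟩
  · rintro _ ⟨h0, W, hW, rfl⟩
    refine ⟨h0, ofInt_le_add_of_le (hT W hW) ?_⟩
    have := hw W hW
    omega
  · rintro _ ⟨x, hx, rfl⟩
    obtain ⟨W, hW, hxW⟩ := hA (affineSimplex w x).1 ⟨_, hx, rfl⟩
    have hxW' : x.1 ∈ W.comap (vertexSum w) := hxW
    refine ⟨_, ⟨fun h => ?_, W, hW, rfl⟩, hxW'⟩
    rw [h, Submodule.mem_bot] at hxW'
    exact delta_coe_ne_zero x hxW'

theorem vertexSum_injective {j k : ℕ} {w : Fin (j + 1) → Delta k}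
    (hw : LinearIndependent ℝ fun l => (w l).1) : LinearMap.ker (vertexSum w) = ⊥ :=
  LinearMap.ker_eq_bot.2 (linearIndependent_iff_injective_fintypeLinearCombination.1 hw)

theorem range_vertexSum {j k : ℕ} (w : Fin (j + 1) → Delta k) :
    LinearMap.range (vertexSum w) = Submodule.span ℝ (Set.range fun l => (w l).1) :=
  Fintype.range_linearCombination ℝ _

section allowable

variable {n : ℕ} {F : Filtration X n} {p : Perversity F}

/-- An injective linear map cannot raise the dimension of a preimage, and the source dimension is
unchanged. -/
theorem Allowable.comp_of_linearIndependent {k : ℕ} {σ : Simplex X k} (h : Allowable p σ)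
    {w : Fin (k + 1) → Delta k} (hw : LinearIndependent ℝ fun l => (w l).1) :
    Allowable p (σ.comp (affineSimplex w) : Simplex X k) := by
  intro S hS
  obtain ⟨T, hfin, hT, hA⟩ := (polyDimLE_iff (Simplex.preimage_subset _ _)).1 (h S hS)
  refine polyDimLE_preimage_comp hfin (fun W hW => (hT W hW).2) hA fun W _ => ?_
  rw [finrank_comap_eq, vertexSum_injective hw, finrank_bot, add_zero]
  exact Nat.add_le_add_right (Submodule.finrank_mono inf_le_right) _

/-- The linear map is onto with kernel of dimension one, so preimages gain exactly the dimension
that the source gains. -/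
theorem Allowable.comp_of_span_eq_top {k : ℕ} {σ : Simplex X k} (h : Allowable p σ)
    {w : Fin (k + 2) → Delta k} (hw : Submodule.span ℝ (Set.range fun l => (w l).1) = ⊤) :
    Allowable p (σ.comp (affineSimplex w) : Simplex X (k + 1)) := by
  intro S hS
  obtain ⟨T, hfin, hT, hA⟩ := (polyDimLE_iff (Simplex.preimage_subset _ _)).1 (h S hS)
  refine polyDimLE_preimage_comp hfin (fun W hW => (hT W hW).2) hA fun W _ => ?_
  have h1 := LinearMap.finrank_range_add_finrank_ker (vertexSum w)
  rw [finrank_comap_eq]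
  rw [range_vertexSum, hw] at h1 ⊢
  rw [finrank_top, Module.finrank_fin_fun, Module.finrank_fin_fun] at h1
  rw [top_inf_eq]
  omega

theorem Filtration.LocallyFinite.finite_meeting (hF : F.LocallyFinite) {k : ℕ} (σ : Simplex X k) :
    {S : F.Stratum | (S.carrier ∩ Set.range σ).Nonempty}.Finite := by
  choose N hN hNfin using hF
  obtain ⟨t, -, ht⟩ := (isCompact_range σ.continuous).elim_nhds_subcover N (fun x _ => hN x)
  refine (t.finite_toSet.biUnion (fun x _ => hNfin x)).subset ?_
  rintro S ⟨y, hyS, hy⟩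
  obtain ⟨x, hx, hyx⟩ := Set.mem_iUnion₂.1 (ht hy)
  exact Set.mem_biUnion (show x ∈ (t : Set X) from hx) ⟨y, hyS, hyx⟩

/-- For an allowable simplex there are finitely many nonzero vectors such that any hyperplane
section that avoids them is allowable as a simplex of one dimension less. -/
theorem Allowable.exists_testVectors (hF : F.LocallyFinite) {k : ℕ} {σ : Simplex X (k + 1)}
    (h : Allowable p σ) :
    ∃ N : Set (Fin (k + 2) → ℝ), N.Finite ∧ (∀ x ∈ N, x ≠ 0) ∧
      ∀ w : Fin (k + 1) → Delta (k + 1), (LinearIndependent ℝ fun l => (w l).1) →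
        (∀ x ∈ N, x ∉ Submodule.span ℝ (Set.range fun l => (w l).1)) →
          Allowable p (σ.comp (affineSimplex w) : Simplex X k) := by
  have h1 : ∀ S : F.Stratum, ∃ T : Set (Submodule ℝ (Fin (k + 2) → ℝ)), T.Finite ∧
      (∀ W ∈ T, W ≠ ⊥) ∧ (S.IsSingular →
      (∀ W ∈ T, ofInt ((Module.finrank ℝ W : ℤ) - 1) ≤
        ofInt (((k + 1 : ℕ) : ℤ) - S.codim) + p.toFun S) ∧
        ∀ x ∈ σ.preimage S.carrier, ∃ W ∈ T, x ∈ W) := by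
    intro S
    by_cases hS : S.IsSingular
    · obtain ⟨T, hfin, hT, hA⟩ := (polyDimLE_iff (Simplex.preimage_subset _ _)).1 (h S hS)
      exact ⟨T, hfin, fun W hW => (hT W hW).1, fun _ => ⟨fun W hW => (hT W hW).2, hA⟩⟩
    · exact ⟨∅, Set.finite_empty, by simp, fun h => absurd h hS⟩
  choose T hfin hT0 hT using h1
  have h2 : ∀ W : Submodule ℝ (Fin (k + 2) → ℝ), ∃ x, W ≠ ⊥ → x ∈ W ∧ x ≠ 0 := by
    intro W
    by_cases hW : W = ⊥
    · exact ⟨0, fun h => absurd hW h⟩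
    · obtain ⟨x, hx, hx0⟩ := W.ne_bot_iff.1 hW
      exact ⟨x, fun _ => ⟨hx, hx0⟩⟩
  choose x hx using h2
  -- One nonzero vector from each covering subspace suffices: a hyperplane that misses it does not
  -- contain the subspace. Only finitely many strata meet the compact image, so the set is finite.
  refine ⟨⋃ S ∈ {S : F.Stratum | (S.carrier ∩ Set.range σ).Nonempty}, x '' T S,
    (hF.finite_meeting σ).biUnion fun S _ => (hfin S).image x, ?_, ?_⟩
  · intro y hy
    obtain ⟨S, -, W, hW, rfl⟩ := Set.mem_iUnion₂.1 hy
    exact (hx W (hT0 S W hW)).2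
  · intro w hw hN S hS
    by_cases hne : (S.carrier ∩ Set.range σ).Nonempty
    · refine polyDimLE_preimage_comp (hfin S) (hT S hS).1 (hT S hS).2 fun W hW => ?_
      rw [finrank_comap_eq, vertexSum_injective hw, finrank_bot, add_zero]
      have hlt : LinearMap.range (vertexSum w) ⊓ W < W := by
        refine lt_of_le_of_ne inf_le_right fun heq => ?_
        refine hN (x W) (Set.mem_biUnion hne ⟨W, hW, rfl⟩) ?_
        have : x W ∈ LinearMap.range (vertexSum w) ⊓ W := by
          rw [heq]
          exact (hx W (hT0 S W hW)).1
        rw [← range_vertexSum]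
        exact this.1
      have := Submodule.finrank_lt_finrank_of_lt hlt
      omega
    · have : Simplex.preimage (σ.comp (affineSimplex w)) S.carrier = ∅ := by
        rw [Set.eq_empty_iff_forall_notMem]
        rintro _ ⟨y, hy, rfl⟩
        exact hne ⟨_, hy, ⟨_, rfl⟩⟩
      rw [this]
      exact ⟨∅, ⟨∅, by simp, by simp⟩, subset_rfl⟩

section chains

variable (R : Type v) [CommRing R] (G : Type w) [AddCommGroup G] [Module R G]

/-- The intersection chains that are combinations of simplexes in `O`. -/
def interChainsIn (p : Perversity F) (O : Set X) (k : ℕ) : Submodule R (Chain X G k) :=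
  interChains R G p k ⊓ Finsupp.supported G R {σ : Simplex X k | Set.range σ ⊆ O}

variable {R G}

theorem mem_interChainsIn {O : Set X} {k : ℕ} {ξ : Chain X G k} :
    ξ ∈ interChainsIn R G p O k ↔
      ξ ∈ interChains R G p k ∧ ∀ σ ∈ ξ.support, Set.range σ ⊆ O := by
  rw [interChainsIn, Submodule.mem_inf, Finsupp.mem_supported]
  rfl

theorem mem_allowableChains {k : ℕ} {ξ : Chain X G k} :
    ξ ∈ allowableChains R G p k ↔ ∀ σ ∈ ξ.support, Allowable p σ := by
  rw [allowableChains, Finsupp.mem_supported]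
  rfl

theorem realize_mem_allowableChains {j k : ℕ} {a : AffineFamily X k j} {ξ : Chain X G k}
    (h : ∀ σ ∈ ξ.support, ∀ w ∈ (a σ).support,
      Allowable p (σ.comp (affineSimplex w) : Simplex X j)) :
    realize R G a ξ ∈ allowableChains R G p j := by
  rw [mem_allowableChains]
  intro τ hτ
  obtain ⟨σ, hσ, w, hw, rfl⟩ := exists_of_mem_support_realize R G hτ
  exact h σ hσ w hw

theorem range_subset_of_mem_support_realize {j k : ℕ} {a : AffineFamily X k j} {ξ : Chain X G k}
    {O : Set X} (h : ∀ σ ∈ ξ.support, Set.range σ ⊆ O) :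
    ∀ τ ∈ (realize R G a ξ).support, Set.range τ ⊆ O := by
  intro τ hτ
  obtain ⟨σ, hσ, w, hw, rfl⟩ := exists_of_mem_support_realize R G hτ
  rintro _ ⟨x, rfl⟩
  exact h σ hσ ⟨_, rfl⟩

theorem subdivision_mem_allowableChains {b : PointChoice X} (hb : b.IsInterior) (L : Set X) {k : ℕ}
    {ξ : Chain X G k} (h : ξ ∈ allowableChains R G p k) :
    realize R G (subdivision b L k) ξ ∈ allowableChains R G p k :=
  realize_mem_allowableChains fun σ hσ _ hw =>
    (mem_allowableChains.1 h σ hσ).comp_of_linearIndependent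
      (linearIndependent_of_mem_subdivision hb hw)

theorem subdivisionHomotopy_mem_allowableChains {b : PointChoice X} (hb : b.IsInterior) {k : ℕ}
    {ξ : Chain X G k} (h : ξ ∈ allowableChains R G p k) :
    realize R G (subdivisionHomotopy b k) ξ ∈ allowableChains R G p (k + 1) :=
  realize_mem_allowableChains fun σ hσ _ hw =>
    (mem_allowableChains.1 h σ hσ).comp_of_span_eq_top
      (span_eq_top_of_mem_subdivisionHomotopy hb hw)

theorem subdivision_mem_interChains {b : PointChoice X} (hb : b.IsInterior) {k : ℕ}
    {ξ : Chain X G k} (h : ξ ∈ interChains R G p k) :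
    realize R G (subdivision b Set.univ k) ξ ∈ interChains R G p k := by
  cases k with
  | zero => exact subdivision_mem_allowableChains hb _ h
  | succ k =>
    refine ⟨subdivision_mem_allowableChains hb _ h.1, ?_⟩
    change boundary R G X k _ ∈ allowableChains R G p k
    rw [boundary_subdivision_univ]
    exact subdivision_mem_allowableChains hb _ h.2

theorem subdivisionHomotopy_mem_interChains {b : PointChoice X} (hb : b.IsInterior) {k : ℕ}
    {ξ : Chain X G k} (h : ξ ∈ interChains R G p k) :
    realize R G (subdivisionHomotopy b k) ξ ∈ interChains R G p (k + 1) := by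
  refine ⟨subdivisionHomotopy_mem_allowableChains hb (interChains_le R G p k h), ?_⟩
  change boundary R G X k _ ∈ allowableChains R G p k
  cases k with
  | zero =>
    have : realize R G (subdivisionHomotopy b 0) ξ = 0 := by
      have h0 : subdivisionHomotopy b 0 = (0 : AffineFamily X 0 1) - 0 := (sub_zero _).symm
      rw [h0, realize_sub, sub_self]
    rw [this, map_zero]
    exact Submodule.zero_mem _
  | succ k =>
    rw [boundary_subdivisionHomotopy]
    exact Submodule.sub_mem _ (Submodule.sub_mem _ h.1 (subdivision_mem_allowableChains hb _ h.1))
      (subdivisionHomotopy_mem_allowableChains hb h.2)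

theorem boundary_subdivisionHomotopy_zero (b : PointChoice X) (ξ : Chain X G 0) :
    boundary R G X 0 (realize R G (subdivisionHomotopy b 0) ξ) =
      ξ - realize R G (subdivision b Set.univ 0) ξ := by
  have h0 : subdivisionHomotopy b 0 = (0 : AffineFamily X 0 1) - 0 := (sub_zero _).symm
  rw [h0, realize_sub, sub_self, map_zero, realize_subdivision_univ_zero, sub_self]

theorem subdivision_mem_interChainsIn {b : PointChoice X} (hb : b.IsInterior) {O : Set X} {k : ℕ}
    {ξ : Chain X G k} (h : ξ ∈ interChainsIn R G p O k) :
    realize R G (subdivision b Set.univ k) ξ ∈ interChainsIn R G p O k :=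
  mem_interChainsIn.2 ⟨subdivision_mem_interChains hb (mem_interChainsIn.1 h).1,
    range_subset_of_mem_support_realize (mem_interChainsIn.1 h).2⟩

theorem subdivisionHomotopy_mem_interChainsIn {b : PointChoice X} (hb : b.IsInterior) {O : Set X}
    {k : ℕ} {ξ : Chain X G k} (h : ξ ∈ interChainsIn R G p O k) :
    realize R G (subdivisionHomotopy b k) ξ ∈ interChainsIn R G p O (k + 1) :=
  mem_interChainsIn.2 ⟨subdivisionHomotopy_mem_interChains hb (mem_interChainsIn.1 h).1,
    range_subset_of_mem_support_realize (mem_interChainsIn.1 h).2⟩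

end chains

end allowable

/-! ### Subdivision in general position -/

open MeasureTheory in
/-- Finitely many proper linear subspaces do not cover the interior of the standard simplex. -/
theorem exists_interior_point_notMem {k : ℕ} {T : Set (Submodule ℝ (Fin (k + 1) → ℝ))}
    (hT : T.Finite) (hT' : ∀ W ∈ T, W ≠ ⊤) :
    ∃ b : Delta k, (∀ i, 0 < b.1 i) ∧ ∀ W ∈ T, b.1 ∉ W := by
  let O : Set (Fin (k + 1) → ℝ) := Set.univ.pi fun _ => Set.Ioi 0
  have hO : IsOpen O := isOpen_set_pi Set.finite_univ fun _ _ => isOpen_Ioi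
  have hO0 : volume O ≠ 0 := (hO.measure_pos volume ⟨fun _ => 1, fun _ _ => one_pos (α := ℝ)⟩).ne'
  have hnull : volume (⋃ W ∈ T, (W : Set (Fin (k + 1) → ℝ))) = 0 :=
    (measure_biUnion_null_iff hT.countable).2 fun W hW =>
      Measure.addHaar_submodule volume W (hT' W hW)
  -- Proper subspaces have measure zero and the open positive orthant does not. Rescaling to
  -- coordinate sum `1` respects both conditions.
  obtain ⟨x, hx, hxT⟩ : (O \ ⋃ W ∈ T, (W : Set (Fin (k + 1) → ℝ))).Nonempty := by
    rw [Set.nonempty_iff_ne_empty, Ne, Set.sdiff_eq_empty]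
    exact fun h => hO0 (measure_mono_null h hnull)
  have hx' : ∀ i, 0 < x i := fun i => hx i trivial
  have hs : 0 < ∑ i, x i := Finset.sum_pos (fun i _ => hx' i) Finset.univ_nonempty
  refine ⟨⟨(∑ i, x i)⁻¹ • x, fun i => ?_, ?_⟩, fun i => ?_, fun W hW h => hxT ?_⟩
  · exact mul_nonneg (inv_pos.2 hs).le (hx' i).le
  · simp only [Pi.smul_apply, smul_eq_mul, ← Finset.mul_sum]
    exact inv_mul_cancel₀ hs.ne'
  · exact mul_pos (inv_pos.2 hs) (hx' i)
  · exact Set.mem_biUnion hW ((W.smul_mem_iff (inv_pos.2 hs).ne').1 h)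

theorem dualFlags_congr {b b' : PointChoice X} {k : ℕ} (h : ∀ l ≤ k, b l = b' l) :
    dualFlags b k = dualFlags b' k := by
  induction k with
  | zero => rfl
  | succ k ih =>
    funext σ
    rw [dualFlags, dualFlags, ih fun l hl => h l (Nat.le_succ_of_le hl), h (k + 1) le_rfl]

/-- The points are chosen by induction on dimension. As `b` depends only on the singular simplex,
common faces automatically receive the same point; `hface` passes the constraints down to the faces,
where earlier choices already satisfy them. -/
theorem exists_generic_pointChoice (N : ∀ k, Simplex X k → Set (Fin (k + 1) → ℝ))
    (hfin : ∀ k σ, (N k σ).Finite)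
    (hface : ∀ k (σ : Simplex X (k + 1)) i y, faceLin i y ∈ N (k + 1) σ → y ∈ N k (σ.face i))
    (m : ℕ) :
    ∃ b : PointChoice X, b.IsInterior ∧ ∀ k ≤ m, ∀ (σ : Simplex X k), ∀ w ∈ dualFlags b k σ,
      ∀ x ∈ N k σ, x ≠ 0 → x ∉ Submodule.span ℝ (Set.range fun l => (w l).1) := by
  classical
  induction m with
  | zero =>
    refine ⟨fun k _ => stdSimplex.barycenter, fun k σ i => ?_, ?_⟩
    · exact inv_pos.2 (Nat.cast_pos.2 Fintype.card_pos)
    · intro k hk σ w _ x _ hx0 hx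
      obtain rfl : k = 0 := Nat.le_zero.1 hk
      rw [Set.range_eq_empty, Submodule.span_empty] at hx
      exact hx0 hx
  | succ m ih =>
    obtain ⟨b, hb, hgen⟩ := ih
    have hex : ∀ σ : Simplex X (m + 1), ∃ c : Delta (m + 1), (∀ i, 0 < c.1 i) ∧
        ∀ i, ∀ w ∈ dualFlags b m (σ.face i), ∀ x ∈ N (m + 1) σ, c.1 ∉ Submodule.span ℝ
          (Set.range (Fin.cons x (faceLin i ∘ fun l => (w l).1) :
            Fin (m + 1) → Fin (m + 2) → ℝ)) := by
      intro σ
      have hT : (⋃ i : Fin (m + 2), Set.image2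
          (fun (w : Fin m → Delta m) (x : Fin (m + 2) → ℝ) => Submodule.span ℝ
            (Set.range (Fin.cons x (faceLin i ∘ fun l => (w l).1) :
              Fin (m + 1) → Fin (m + 2) → ℝ)))
            (dualFlags b m (σ.face i)) (N (m + 1) σ)).Finite :=
        Set.finite_iUnion fun i => Set.Finite.image2 _ (finite_dualFlags b m _) (hfin _ _)
      -- A forbidden subspace is spanned by `m + 1` vectors in dimension `m + 2`, so it is proper.
      obtain ⟨c, hc, hcT⟩ := exists_interior_point_notMem hT (by
        intro W hW
        obtain ⟨i, w, hw, x, hx, rfl⟩ := Set.mem_iUnion.1 hW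
        intro htop
        have h1 := finrank_range_le_card (R := ℝ)
          (b := (Fin.cons x (faceLin i ∘ fun l => (w l).1) : Fin (m + 1) → Fin (m + 2) → ℝ))
        dsimp only at htop
        rw [Set.finrank, htop, finrank_top, Module.finrank_fin_fun, Fintype.card_fin] at h1
        omega)
      exact ⟨c, hc, fun i w hw x hx => hcT _ (Set.mem_iUnion.2 ⟨i, w, hw, x, hx, rfl⟩)⟩
    choose c hc hcT using hex
    refine ⟨Function.update b (m + 1) c, ?_, ?_⟩
    · intro k σ i
      by_cases hk : k = m + 1
      · subst hk
        rw [Function.update_self]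
        exact hc σ i
      · rw [Function.update_of_ne hk]
        exact hb k σ i
    · have hcongr : ∀ k ≤ m, dualFlags (Function.update b (m + 1) c) k = dualFlags b k :=
        fun k hk => dualFlags_congr fun l hl => Function.update_of_ne (by omega) _ _
      intro k hk σ w hw x hx hx0 hxw
      rcases Nat.le_succ_iff.1 hk with hk | rfl
      · rw [hcongr k hk] at hw
        exact hgen k hk σ w hw x hx hx0 hxw
      · obtain ⟨i, w', hw', rfl⟩ := hw
        rw [hcongr m le_rfl] at hw'
        rw [Function.update_self, coe_cons_comp_vertexMap, Fin.range_cons,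
          Submodule.mem_span_insert] at hxw
        obtain ⟨a, y, hy, hxy⟩ := hxw
        -- If the new point does not contribute, `x` lies in the space of a face and the induction
        -- hypothesis excludes it. Otherwise the relation can be solved for the new point, which was
        -- chosen outside that span.
        by_cases ha : a = 0
        · rw [ha, zero_smul, zero_add] at hxy
          subst hxy
          rw [Set.range_comp, ← Submodule.map_span] at hy
          obtain ⟨z, hz, rfl⟩ := hy
          refine hgen m le_rfl _ w' hw' z (hface _ _ _ _ hx) (fun h => hx0 ?_) hz
          rw [h, map_zero]
        · refine hcT σ i w' hw' x hx ?_
          rw [Fin.range_cons, Submodule.mem_span_insert]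
          refine ⟨a⁻¹, -(a⁻¹ • y), Submodule.neg_mem _ (Submodule.smul_mem _ _ hy), ?_⟩
          rw [hxy, smul_add, smul_smul, inv_mul_cancel₀ ha, one_smul, add_neg_cancel_right]

/-- The vectors in faces of the given simplexes that belong to the given sets. -/
def faceVectors {K : ℕ} (A : Set (Simplex X K)) (N : Simplex X K → Set (Fin (K + 1) → ℝ)) (k : ℕ)
    (τ : Simplex X k) : Set (Fin (k + 1) → ℝ) :=
  {y | ∃ θ : Fin (k + 1) → Fin (K + 1), Function.Injective θ ∧ ∃ σ ∈ A,
    τ = σ.comp (vertexMap θ) ∧ vertexSum (fun i => stdSimplex.vertex (θ i)) y ∈ N σ}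

/-- One singular simplex can be a face of several members of `A`, in several ways. There are
finitely many such ways, and each pulls a finite set back along an injective map. -/
theorem finite_faceVectors {K : ℕ} {A : Set (Simplex X K)} (hA : A.Finite)
    {N : Simplex X K → Set (Fin (K + 1) → ℝ)} (hN : ∀ σ, (N σ).Finite) (k : ℕ)
    (τ : Simplex X k) : (faceVectors A N k τ).Finite := by
  have h : (⋃ θ ∈ {θ : Fin (k + 1) → Fin (K + 1) | Function.Injective θ}, ⋃ σ ∈ A,
      (vertexSum fun i => stdSimplex.vertex (θ i)) ⁻¹' N σ).Finite := by
    refine Set.Finite.biUnion (Set.toFinite _) fun θ hθ => hA.biUnion fun σ _ =>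
      (hN σ).preimage (Set.injOn_of_injective (LinearMap.ker_eq_bot.1 (vertexSum_injective ?_)))
    have := (Pi.basisFun ℝ (Fin (K + 1))).linearIndependent.comp θ hθ
    have e : (fun l => (stdSimplex.vertex (θ l) : Delta K).1) = Pi.basisFun ℝ (Fin (K + 1)) ∘ θ :=
      funext fun l => (Pi.basisFun_apply ℝ _ (θ l)).symm
    exact e ▸ this
  refine h.subset ?_
  rintro y ⟨θ, hθ, σ, hσ, -, hy⟩
  exact Set.mem_biUnion hθ (Set.mem_biUnion hσ hy)

theorem faceVectors_face {K : ℕ} {A : Set (Simplex X K)} {N : Simplex X K → Set (Fin (K + 1) → ℝ)}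
    (k : ℕ) (τ : Simplex X (k + 1)) (i : Fin (k + 2)) (y : Fin (k + 1) → ℝ)
    (h : faceLin i y ∈ faceVectors A N (k + 1) τ) : y ∈ faceVectors A N k (τ.face i) := by
  obtain ⟨θ, hθ, σ, hσ, rfl, hy⟩ := h
  refine ⟨θ ∘ i.succAbove, hθ.comp (Fin.succAbove_right_injective), σ, hσ, ?_, ?_⟩
  · rw [Simplex.face_eq, ContinuousMap.comp_assoc, vertexMap_comp]
  · rw [faceLin, vertexSum_vertexSum] at hy
    convert hy using 3
    funext l
    exact (affineSimplex_vertex (fun i => stdSimplex.vertex (θ i)) (i.succAbove l)).symm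

theorem subset_faceVectors {K : ℕ} {A : Set (Simplex X K)}
    {N : Simplex X K → Set (Fin (K + 1) → ℝ)} {σ : Simplex X K} (hσ : σ ∈ A) :
    N σ ⊆ faceVectors A N K σ := by
  intro y hy
  refine ⟨id, Function.injective_id, σ, hσ, ?_, ?_⟩
  · exact ((congrArg σ.comp (affineSimplex_vertices K)).trans (ContinuousMap.comp_id σ)).symm
  · exact (vertexSum_vertices y).symm ▸ hy

section chains

variable {n : ℕ} {F : Filtration X n} {p : Perversity F}
  {R : Type v} [CommRing R] {G : Type w} [AddCommGroup G] [Module R G]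

/-- For a subdivision in general position, all partial subdivisions of an intersection chain are
intersection chains. -/
theorem exists_partialSubdivision_mem_interChains (hF : F.LocallyFinite) {k : ℕ}
    {ξ : Chain X G k} (h : ξ ∈ interChains R G p k) :
    ∃ b : PointChoice X, b.IsInterior ∧ ∀ L : Set X,
      realize R G (subdivision b L k) ξ ∈ interChains R G p k := by
  cases k with
  | zero =>
    have hb : PointChoice.IsInterior (fun k _ => stdSimplex.barycenter : PointChoice X) :=
      fun k σ i => inv_pos.2 (Nat.cast_pos.2 Fintype.card_pos)
    exact ⟨_, hb, fun L => subdivision_mem_allowableChains hb L h⟩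
  | succ k =>
    have h1 : ∀ σ : Simplex X (k + 1), ∃ N : Set (Fin (k + 2) → ℝ), N.Finite ∧
        (Allowable p σ → (∀ x ∈ N, x ≠ 0) ∧
          ∀ w : Fin (k + 1) → Delta (k + 1), (LinearIndependent ℝ fun l => (w l).1) →
            (∀ x ∈ N, x ∉ Submodule.span ℝ (Set.range fun l => (w l).1)) →
              Allowable p (σ.comp (affineSimplex w) : Simplex X k)) := by
      intro σ
      by_cases hσ : Allowable p σ
      · obtain ⟨N, h1, h2⟩ := hσ.exists_testVectors hF
        exact ⟨N, h1, fun _ => h2⟩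
      · exact ⟨∅, Set.finite_empty, fun h => absurd h hσ⟩
    choose N hNfin hN using h1
    obtain ⟨b, hb, hgen⟩ := exists_generic_pointChoice (faceVectors (ξ.support : Set _) N)
      (finite_faceVectors ξ.support.finite_toSet hNfin) faceVectors_face (k + 1)
    have hξ := mem_allowableChains.1 h.1
    refine ⟨b, hb, fun L => ⟨subdivision_mem_allowableChains hb L h.1, ?_⟩⟩
    change boundary R G X k _ ∈ allowableChains R G p k
    rw [boundary_subdivision]
    -- The first term is allowable because `∂ξ` is. The second consists of dual simplexes, for which
    -- general position is required.
    refine Submodule.sub_mem _ (subdivision_mem_allowableChains hb L h.2) ?_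
    refine realize_mem_allowableChains fun σ hσ w hw => ?_
    have hwf := mem_dualFlags_of_mem_support hw
    refine (hN σ (hξ σ hσ)).2 w (linearIndependent_of_mem_dualFlags hb hwf) fun x hx => ?_
    exact hgen (k + 1) le_rfl σ w hwf x (subset_faceVectors (A := (ξ.support : Set _)) hσ hx)
      ((hN σ (hξ σ hσ)).1 x hx)

end chains

/-! ### The mesh of the iterated barycentric subdivision -/

/-- The choice of the barycenters. -/
def barycenterChoice (X : Type u) [TopologicalSpace X] : PointChoice X :=
  fun _ _ => stdSimplex.barycenter

theorem isInterior_barycenterChoice : (barycenterChoice X).IsInterior :=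
  fun _ _ _ => inv_pos.2 (Nat.cast_pos.2 Fintype.card_pos)

section mesh

variable {E : Type*} [NormedAddCommGroup E] [NormedSpace ℝ E]

/-- Closed balls are convex, so a bound at the vertices holds on the simplex. -/
theorem norm_sub_map_le {k : ℕ} (A : (Fin (k + 1) → ℝ) →ₗ[ℝ] E) {M : ℝ} {v : E}
    (h : ∀ l, ‖v - A (Pi.single l 1)‖ ≤ M) (y : Delta k) : ‖v - A y.1‖ ≤ M := by
  have h1 : A y.1 = ∑ l, y.1 l • A (Pi.single l 1) := by
    conv_lhs => rw [← vertexSum_vertices y.1, vertexSum_apply, map_sum]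
    exact Finset.sum_congr rfl fun l _ => map_smul _ _ _
  have h2 : A y.1 ∈ Metric.closedBall v M := by
    rw [h1]
    refine (convex_closedBall v M).sum_mem (fun l _ => y.2.1 l) y.2.2 fun l _ => ?_
    rw [mem_closedBall_iff_norm']
    exact h l
  rwa [mem_closedBall_iff_norm'] at h2

theorem norm_map_sub_map_le {k : ℕ} (A : (Fin (k + 1) → ℝ) →ₗ[ℝ] E) {M : ℝ}
    (h : ∀ i l, ‖A (Pi.single i 1) - A (Pi.single l 1)‖ ≤ M) (x y : Delta k) :
    ‖A x.1 - A y.1‖ ≤ M := by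
  refine norm_sub_map_le A (fun l => ?_) y
  rw [norm_sub_rev]
  refine norm_sub_map_le A (fun i => ?_) x
  exact h l i

/-- The difference is the average of `k + 1` differences of vertices, one of which is zero. -/
theorem norm_barycenter_sub_le {k : ℕ} (A : (Fin (k + 1) → ℝ) →ₗ[ℝ] E) {M : ℝ}
    (h : ∀ i l, ‖A (Pi.single i 1) - A (Pi.single l 1)‖ ≤ M) (l : Fin (k + 1)) :
    ‖A (stdSimplex.barycenter : Delta k).1 - A (Pi.single l 1)‖ ≤ (k : ℝ) / (k + 1) * M := by
  have hk : (0 : ℝ) < k + 1 := by positivity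
  have h1 : A (stdSimplex.barycenter : Delta k).1 - A (Pi.single l 1) =
      ∑ i, ((k : ℝ) + 1)⁻¹ • (A (Pi.single i 1) - A (Pi.single l 1)) := by
    conv_lhs => rw [← vertexSum_vertices (stdSimplex.barycenter : Delta k).1, vertexSum_apply]
    simp only [smul_sub, Finset.sum_sub_distrib, Finset.sum_const, Finset.card_univ,
      Fintype.card_fin, map_sum, map_smul]
    congr 1
    · refine Finset.sum_congr rfl fun i _ => ?_
      simp [stdSimplex.barycenter]
    · rw [← Nat.cast_smul_eq_nsmul ℝ, smul_smul, Nat.cast_succ, mul_inv_cancel₀ hk.ne', one_smul]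
  rw [h1, ← Finset.add_sum_erase _ _ (Finset.mem_univ l), sub_self, smul_zero, zero_add]
  refine (norm_sum_le _ _).trans ((Finset.sum_le_card_nsmul _ _ ((k + 1 : ℝ)⁻¹ * M) ?_).trans ?_)
  · intro i _
    rw [norm_smul, Real.norm_of_nonneg (inv_pos.2 hk).le]
    exact mul_le_mul_of_nonneg_left (h i l) (inv_pos.2 hk).le
  · rw [Finset.card_erase_of_mem (Finset.mem_univ l), Finset.card_univ, Fintype.card_fin,
      Nat.add_sub_cancel, nsmul_eq_mul, div_eq_mul_inv, mul_assoc]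

/-- A general linear map `A` is allowed so that the induction can restrict it to a face, and so that
the estimate can be iterated. -/
theorem norm_sub_le_of_mem_barycentric {L : Set X} {k : ℕ} {σ : Simplex X k}
    {w : Fin (k + 1) → Delta k} (hw : w ∈ (subdivision (barycenterChoice X) L k σ).support)
    (A : (Fin (k + 1) → ℝ) →ₗ[ℝ] E) {M : ℝ}
    (h : ∀ i l, ‖A (Pi.single i 1) - A (Pi.single l 1)‖ ≤ M) (i l : Fin (k + 1)) :
    ‖A (w i).1 - A (w l).1‖ ≤ (k : ℝ) / (k + 1) * M := by
  induction k with
  | zero =>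
    have : i = l := Subsingleton.elim (α := Fin 1) i l
    subst this
    simp
  | succ k ih =>
    have hM : 0 ≤ M := (norm_nonneg _).trans (h 0 0)
    obtain ⟨m, w', hw', rfl⟩ := exists_of_mem_support_subdivision hw
    have hb := norm_barycenter_sub_le A h
    have hbm : ∀ y : Delta (k + 1), ‖A (stdSimplex.barycenter : Delta (k + 1)).1 - A y.1‖ ≤
        ((k + 1 : ℕ) : ℝ) / ((k + 1 : ℕ) + 1) * M := norm_sub_map_le A hb
    refine Fin.cases ?_ (fun i => ?_) i <;> refine Fin.cases ?_ (fun l => ?_) l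
    · rw [sub_self, norm_zero]
      positivity
    · exact hbm _
    · rw [norm_sub_rev]
      exact hbm _
    · have := ih hw' (A ∘ₗ faceLin m) (fun i l => by
        simpa [faceLin, vertexSum_single] using h (m.succAbove i) (m.succAbove l)) i l
      -- The factor for the face is no larger, since `k / (k + 1)` increases with `k`.
      refine this.trans (mul_le_mul_of_nonneg_right ?_ hM)
      rw [div_le_div_iff₀ (by positivity) (by positivity)]
      push_cast
      nlinarith

end mesh

section chains

variable (R : Type v) [CommRing R] (G : Type w) [AddCommGroup G] [Module R G]

/-- The iterated barycentric subdivision. -/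
def iteratedSubdivision (k m : ℕ) (ξ : Chain X G k) : Chain X G k :=
  (realize R G (subdivision (barycenterChoice X) Set.univ k))^[m] ξ

theorem iteratedSubdivision_succ (k m : ℕ) (ξ : Chain X G k) :
    iteratedSubdivision R G k (m + 1) ξ =
      realize R G (subdivision (barycenterChoice X) Set.univ k) (iteratedSubdivision R G k m ξ) :=
  Function.iterate_succ_apply' _ _ _

theorem exists_of_mem_support_iteratedSubdivision {k m : ℕ} {ξ : Chain X G k} {τ : Simplex X k}
    (h : τ ∈ (iteratedSubdivision R G k m ξ).support) :
    ∃ σ ∈ ξ.support, ∃ w : Fin (k + 1) → Delta k, τ = σ.comp (affineSimplex w) ∧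
      ∀ i l, ‖(w i).1 - (w l).1‖ ≤ ((k : ℝ) / (k + 1)) ^ m := by
  induction m generalizing τ with
  | zero =>
    refine ⟨τ, h, fun i => stdSimplex.vertex i, ?_, fun i l => ?_⟩
    · exact ((congrArg τ.comp (affineSimplex_vertices k)).trans (ContinuousMap.comp_id τ)).symm
    · rw [pow_zero, pi_norm_le_iff_of_nonneg zero_le_one]
      intro j
      have h1 := mem_Icc_of_mem_stdSimplex (stdSimplex.vertex i : Delta k).2 j
      have h2 := mem_Icc_of_mem_stdSimplex (stdSimplex.vertex l : Delta k).2 j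
      rw [Pi.sub_apply, Real.norm_eq_abs, abs_le]
      constructor <;> linarith [h1.1, h1.2, h2.1, h2.2]
  | succ m ih =>
    rw [iteratedSubdivision_succ] at h
    obtain ⟨τ', hτ', w', hw', rfl⟩ := exists_of_mem_support_realize R G h
    obtain ⟨σ, hσ, w, rfl, hw⟩ := ih hτ'
    refine ⟨σ, hσ, affineSimplex w ∘ w', ?_, fun i l => ?_⟩
    · rw [ContinuousMap.comp_assoc, affineSimplex_comp]
    · rw [pow_succ']
      refine norm_sub_le_of_mem_barycentric hw' (vertexSum w) (fun i l => ?_) i l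
      rw [vertexSum_single, vertexSum_single]
      exact hw i l

theorem dist_affineSimplex_le {j k : ℕ} {w : Fin (j + 1) → Delta k} {M : ℝ}
    (h : ∀ i l, ‖(w i).1 - (w l).1‖ ≤ M) (x y : Delta j) :
    dist (affineSimplex w x) (affineSimplex w y) ≤ M := by
  rw [Subtype.dist_eq, dist_eq_norm]
  refine norm_map_sub_map_le (vertexSum w) (fun i l => ?_) x y
  rw [vertexSum_single, vertexSum_single]
  exact h i l

/-- A sufficiently iterated subdivision of a chain is small, and the vertices of its simplexes
can be labelled so that the simplexes with a vertex in `L` (not in `L`) lie in `U` (in `V`). -/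
theorem exists_small_iteratedSubdivision [T2Space X] {U V : Opens X} (hcover : U ⊔ V = ⊤) {k : ℕ}
    (ξ : Chain X G k) :
    ∃ (m : ℕ) (L : Set X), ∀ τ ∈ (iteratedSubdivision R G k m ξ).support,
      ((∃ x, τ x ∈ L) → Set.range τ ⊆ U) ∧ ((∃ x, τ x ∉ L) → Set.range τ ⊆ V) := by
  have hcov : ∀ x, x ∈ U ∨ x ∈ V := fun x => by
    have : x ∈ U ⊔ V := hcover ▸ Opens.mem_top x
    simpa using this
  let K : Set X := ⋃ σ ∈ ξ.support, Set.range σ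
  have hK : IsCompact K :=
    ξ.support.finite_toSet.isCompact_biUnion fun σ _ => isCompact_range σ.continuous
  -- The compact parts of the image outside `U` and outside `V` are disjoint because `U` and `V`
  -- cover. Together with `U ∩ V`, their disjoint neighbourhoods cover the image, and a Lebesgue
  -- number puts each small simplex in one of the three sets.
  obtain ⟨OA, OB, hOA, hOB, hA, hB, hdisj⟩ : SeparatedNhds (K \ U) (K \ V) :=
    SeparatedNhds.of_isCompact_isCompact (hK.diff U.isOpen) (hK.diff V.isOpen) (by
      rw [Set.disjoint_left]
      rintro x ⟨-, hxU⟩ ⟨-, hxV⟩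
      exact (hcov x).elim hxU hxV)
  have hlim : Filter.Tendsto (fun m : ℕ => ((k : ℝ) / (k + 1)) ^ m) Filter.atTop (𝓝 0) :=
    tendsto_pow_atTop_nhds_zero_of_lt_one (by positivity)
      ((div_lt_one (by positivity)).2 (lt_add_one _))
  have hleb : ∀ σ ∈ ξ.support, ∀ᶠ m : ℕ in Filter.atTop, ∀ w : Fin (k + 1) → Delta k,
      (∀ i l, ‖(w i).1 - (w l).1‖ ≤ ((k : ℝ) / (k + 1)) ^ m) →
      ∃ c ∈ ({(U : Set X) ∩ V, OA, OB} : Set (Set X)),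
        Set.range (σ.comp (affineSimplex w)) ⊆ c := by
    intro σ hσ
    obtain ⟨δ, hδ, hball⟩ := lebesgue_number_lemma_of_metric (s := (Set.univ : Set (Delta k)))
      (c := fun c : ({(U : Set X) ∩ V, OA, OB} : Set (Set X)) => σ ⁻¹' c.1) isCompact_univ (by
        rintro ⟨c, rfl | rfl | rfl⟩
        · exact (U.isOpen.inter V.isOpen).preimage σ.continuous
        · exact hOA.preimage σ.continuous
        · exact hOB.preimage σ.continuous) (by
        intro x _
        have hxK : σ x ∈ K := Set.mem_biUnion hσ ⟨x, rfl⟩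
        rw [Set.mem_iUnion]
        by_cases hU : σ x ∈ U
        · by_cases hV : σ x ∈ V
          · exact ⟨⟨(U : Set X) ∩ V, by simp⟩, hU, hV⟩
          · exact ⟨⟨OB, by simp⟩, hB ⟨hxK, hV⟩⟩
        · exact ⟨⟨OA, by simp⟩, hA ⟨hxK, hU⟩⟩)
    filter_upwards [hlim.eventually (gt_mem_nhds hδ)] with m hm w hw
    obtain ⟨⟨c, hc⟩, hcw⟩ := hball (affineSimplex w stdSimplex.barycenter) trivial
    refine ⟨c, hc, ?_⟩
    rintro _ ⟨x, rfl⟩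
    exact hcw (Metric.mem_ball.2 ((dist_affineSimplex_le hw _ _).trans_lt hm))
  obtain ⟨m, hm⟩ := ((Filter.eventually_all_finset ξ.support).2 hleb).exists
  -- With `L = OAᶜ`, a simplex in `OA` has no point in `L` and lies in `V`; one in `OB` has all its
  -- points in `L` and lies in `U`; one in `U ∩ V` may carry any labels.
  refine ⟨m, OAᶜ, fun τ hτ => ?_⟩
  obtain ⟨σ, hσ, w, rfl, hw⟩ := exists_of_mem_support_iteratedSubdivision R G hτ
  have hKσ : Set.range (σ.comp (affineSimplex w)) ⊆ K := by
    rintro _ ⟨x, rfl⟩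
    exact Set.mem_biUnion hσ ⟨_, rfl⟩
  obtain ⟨c, rfl | rfl | rfl, hc⟩ := hm σ hσ w hw
  · exact ⟨fun _ => hc.trans Set.inter_subset_left, fun _ => hc.trans Set.inter_subset_right⟩
  · refine ⟨fun ⟨x, hx⟩ => absurd (hc ⟨x, rfl⟩) hx, fun _ y hy => ?_⟩
    by_contra hyV
    exact Set.disjoint_left.1 hdisj (hc hy) (hB ⟨hKσ hy, hyV⟩)
  · refine ⟨fun _ y hy => ?_, fun ⟨x, hx⟩ => ?_⟩
    · by_contra hyU
      exact Set.disjoint_left.1 hdisj (hA ⟨hKσ hy, hyU⟩) (hc hy)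
    · exact absurd (hc ⟨x, rfl⟩) (Set.disjoint_left.1 hdisj (Set.notMem_compl_iff.1 hx))

end chains

/-! ### Small intersection chains -/

section small

variable {n : ℕ} {F : Filtration X n} {p : Perversity F}
  {R : Type v} [CommRing R] {G : Type w} [AddCommGroup G] [Module R G] {U V : Opens X}

/-- Sums of intersection chains in `U` and in `V`. -/
def smallChains (R : Type v) [CommRing R] (G : Type w) [AddCommGroup G] [Module R G]
    (p : Perversity F) (U V : Opens X) (k : ℕ) : Submodule R (Chain X G k) :=
  interChainsIn R G p U k ⊔ interChainsIn R G p V k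

theorem subdivision_mem_smallChains {b : PointChoice X} (hb : b.IsInterior) {k : ℕ}
    {ξ : Chain X G k} (h : ξ ∈ smallChains R G p U V k) :
    realize R G (subdivision b Set.univ k) ξ ∈ smallChains R G p U V k := by
  obtain ⟨y, hy, z, hz, rfl⟩ := Submodule.mem_sup.1 h
  rw [map_add]
  exact Submodule.add_mem_sup (subdivision_mem_interChainsIn hb hy)
    (subdivision_mem_interChainsIn hb hz)

theorem subdivisionHomotopy_mem_smallChains {b : PointChoice X} (hb : b.IsInterior) {k : ℕ}
    {ξ : Chain X G k} (h : ξ ∈ smallChains R G p U V k) :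
    realize R G (subdivisionHomotopy b k) ξ ∈ smallChains R G p U V (k + 1) := by
  obtain ⟨y, hy, z, hz, rfl⟩ := Submodule.mem_sup.1 h
  rw [map_add]
  exact Submodule.add_mem_sup (subdivisionHomotopy_mem_interChainsIn hb hy)
    (subdivisionHomotopy_mem_interChainsIn hb hz)

theorem exists_subdivision_mem_smallChains [T2Space X] (hF : F.LocallyFinite)
    (hcover : U ⊔ V = ⊤) {k : ℕ} {ξ : Chain X G k} (h : ξ ∈ interChains R G p k) :
    ∃ (m : ℕ) (b : PointChoice X), b.IsInterior ∧
      realize R G (subdivision b Set.univ k) (iteratedSubdivision R G k m ξ) ∈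
        smallChains R G p U V k := by
  obtain ⟨m, L, hL⟩ := exists_small_iteratedSubdivision R G hcover ξ
  have hm : iteratedSubdivision R G k m ξ ∈ interChains R G p k := by
    clear hL
    induction m with
    | zero => exact h
    | succ m ih =>
      rw [iteratedSubdivision_succ]
      exact subdivision_mem_interChains isInterior_barycenterChoice ih
  obtain ⟨b, hb, hbL⟩ := exists_partialSubdivision_mem_interChains hF hm
  refine ⟨m, b, hb, ?_⟩
  -- The generic subdivision is applied last and only cuts simplexes that are already small, so its
  -- own mesh does not matter.
  rw [← subdivision_add_compl b L, realize_add]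
  refine Submodule.add_mem_sup (mem_interChainsIn.2 ⟨hbL L, ?_⟩)
    (mem_interChainsIn.2 ⟨hbL Lᶜ, ?_⟩)
  · intro τ hτ
    obtain ⟨σ, hσ, w, hw, rfl⟩ := exists_of_mem_support_realize R G hτ
    exact (Set.range_comp_subset_range (affineSimplex w) σ).trans
      ((hL σ hσ).1 (exists_mem_of_mem_support_subdivision hw))
  · intro τ hτ
    obtain ⟨σ, hσ, w, hw, rfl⟩ := exists_of_mem_support_realize R G hτ
    exact (Set.range_comp_subset_range (affineSimplex w) σ).trans
      ((hL σ hσ).2 (exists_mem_of_mem_support_subdivision hw))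

/-- The cycles; in degree `0` all chains are cycles. -/
def IsSingularCycle (R : Type v) [CommRing R] {G : Type w} [AddCommGroup G] [Module R G] :
    ∀ {k : ℕ}, Chain X G k → Prop
  | 0, _ => True
  | k + 1, ξ => boundary R G X k ξ = 0

theorem IsSingularCycle.subdivision {b : PointChoice X} {k : ℕ} {ξ : Chain X G k}
    (h : IsSingularCycle R ξ) : IsSingularCycle R (realize R G (subdivision b Set.univ k) ξ) := by
  cases k with
  | zero => trivial
  | succ k =>
    change boundary R G X k _ = 0
    rw [boundary_subdivision_univ, (show boundary R G X k ξ = 0 from h), map_zero]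

theorem IsSingularCycle.boundary_homotopy {b : PointChoice X} {k : ℕ} {ξ : Chain X G k}
    (h : IsSingularCycle R ξ) :
    boundary R G X k (realize R G (subdivisionHomotopy b k) ξ) =
      ξ - realize R G (PolyIH.subdivision b Set.univ k) ξ := by
  cases k with
  | zero => exact boundary_subdivisionHomotopy_zero b ξ
  | succ k =>
    rw [boundary_subdivisionHomotopy, (show boundary R G X k ξ = 0 from h), map_zero, sub_zero]

/-- For a cycle the homotopy formula reads `∂Tξ = ξ - sd ξ`; the homotopies of the successive
subdivisions are added up. -/
theorem exists_small_cycle [T2Space X] (hF : F.LocallyFinite) (hcover : U ⊔ V = ⊤) {k : ℕ}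
    {ξ : Chain X G k} (h : ξ ∈ interChains R G p k) (hξ : IsSingularCycle R ξ) :
    ∃ ζ ∈ smallChains R G p U V k, ∃ η ∈ interChains R G p (k + 1),
      ξ = ζ + boundary R G X k η := by
  obtain ⟨m, b, hb, hmb⟩ := exists_subdivision_mem_smallChains (U := U) (V := V) hF hcover h
  have key : ∀ m, iteratedSubdivision R G k m ξ ∈ interChains R G p k ∧
      IsSingularCycle R (iteratedSubdivision R G k m ξ) ∧ ∃ η ∈ interChains R G p (k + 1),
        ξ = iteratedSubdivision R G k m ξ + boundary R G X k η := by
    intro m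
    induction m with
    | zero => exact ⟨h, hξ, 0, Submodule.zero_mem _, by rw [map_zero, add_zero]; rfl⟩
    | succ m ih =>
      obtain ⟨h1, h2, η, hη, h3⟩ := ih
      rw [iteratedSubdivision_succ]
      refine ⟨subdivision_mem_interChains isInterior_barycenterChoice h1, h2.subdivision, η + _,
        Submodule.add_mem _ hη
          (subdivisionHomotopy_mem_interChains isInterior_barycenterChoice h1), ?_⟩
      rw [map_add, h2.boundary_homotopy]
      nth_rewrite 1 [h3]
      abel
  obtain ⟨h1, h2, η, hη, h3⟩ := key m
  refine ⟨_, hmb, η + _, Submodule.add_mem _ hη (subdivisionHomotopy_mem_interChains hb h1), ?_⟩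
  rw [map_add, h2.boundary_homotopy]
  nth_rewrite 1 [h3]
  abel

theorem boundary_boundary_apply (k : ℕ) (ξ : Chain X G (k + 2)) :
    boundary R G X k (boundary R G X (k + 1) ξ) = 0 :=
  LinearMap.congr_fun (boundary_boundary R G X k) ξ

/-- Apply `∂` to the homotopy formula. -/
theorem boundary_subdivision_add {b : PointChoice X} {k : ℕ} (ξ : Chain X G (k + 1)) :
    boundary R G X k ξ = boundary R G X k (realize R G (subdivision b Set.univ (k + 1)) ξ) +
      boundary R G X k (realize R G (subdivisionHomotopy b k) (boundary R G X k ξ)) := by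
  have h := congrArg (boundary R G X k) (boundary_subdivisionHomotopy R G b k ξ)
  rw [boundary_boundary_apply, map_sub, map_sub] at h
  rw [← sub_eq_zero, ← sub_sub]
  exact h.symm

/-- When `∂ξ` is small, so is the correction `T∂ξ`, because `T` preserves intersection chains in `U`
and in `V`. Hence `ξ` may be replaced by its subdivisions, of which the last is small. -/
theorem exists_small_bounding [T2Space X] (hF : F.LocallyFinite) (hcover : U ⊔ V = ⊤) {k : ℕ}
    {ξ : Chain X G (k + 1)} (h : ξ ∈ interChains R G p (k + 1))
    (hξ : boundary R G X k ξ ∈ smallChains R G p U V k) :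
    ∃ ζ ∈ smallChains R G p U V (k + 1), boundary R G X k ξ = boundary R G X k ζ := by
  obtain ⟨m, b, hb, hmb⟩ := exists_subdivision_mem_smallChains (U := U) (V := V) hF hcover h
  have key : ∀ m, boundary R G X k (iteratedSubdivision R G (k + 1) m ξ) ∈
      smallChains R G p U V k ∧ ∃ ζ ∈ smallChains R G p U V (k + 1),
        boundary R G X k ξ =
          boundary R G X k (iteratedSubdivision R G (k + 1) m ξ) + boundary R G X k ζ := by
    intro m
    induction m with
    | zero => exact ⟨hξ, 0, Submodule.zero_mem _, by rw [map_zero, add_zero]; rfl⟩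
    | succ m ih =>
      obtain ⟨h1, ζ, hζ, h2⟩ := ih
      rw [iteratedSubdivision_succ, boundary_subdivision_univ]
      refine ⟨subdivision_mem_smallChains isInterior_barycenterChoice h1, ζ + _,
        Submodule.add_mem _ hζ
          (subdivisionHomotopy_mem_smallChains isInterior_barycenterChoice h1), ?_⟩
      rw [boundary_subdivision_add (b := barycenterChoice X) (iteratedSubdivision R G _ m ξ),
        boundary_subdivision_univ] at h2
      refine h2.trans ?_
      rw [map_add]
      abel
  obtain ⟨h1, ζ, hζ, h2⟩ := key m
  refine ⟨_, Submodule.add_mem _ hmb (Submodule.add_mem _ hζ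
    (subdivisionHomotopy_mem_smallChains hb h1)), ?_⟩
  rw [boundary_subdivision_add (b := b) (iteratedSubdivision R G _ m ξ)] at h2
  refine h2.trans ?_
  rw [map_add, map_add]
  abel

end small

/-! ### Chains in open subspaces -/

section opens

variable {Y : Type u} [TopologicalSpace Y] {n : ℕ} {F : Filtration X n} {p : Perversity F}
  {R : Type v} [CommRing R] {G : Type w} [AddCommGroup G] [Module R G]

theorem comp_injective {g : C(Y, X)} (hg : Function.Injective g) (k : ℕ) :
    Function.Injective fun σ : Simplex Y k => (g.comp σ : Simplex X k) := fun _ _ h =>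
  ContinuousMap.ext fun x => hg (congrArg (fun f : Simplex X k => f x) h)

theorem chainMap_injective {g : C(Y, X)} (hg : Function.Injective g) (k : ℕ) :
    Function.Injective (chainMap R G g k) :=
  Finsupp.mapDomain_injective (comp_injective hg k)

theorem incl_injective (U : Opens X) : Function.Injective (incl U) := Subtype.val_injective

theorem inclLE_injective {U V : Opens X} (h : U ≤ V) : Function.Injective (inclLE h) :=
  Set.inclusion_injective h

theorem chainMap_inclLE {U V : Opens X} (h : U ≤ V) (k : ℕ) (ξ : Chain U G k) :
    chainMap R G (incl V) k (chainMap R G (inclLE h) k ξ) = chainMap R G (incl U) k ξ :=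
  (Finsupp.mapDomain_comp (v := ξ)).symm

/-- Injectivity of `g` excludes cancellation, so each simplex of `ζ` survives in the image. -/
theorem allowable_of_chainMap {g : C(Y, X)} (hg : Function.Injective g) {k : ℕ} {ζ : Chain Y G k}
    (h : chainMap R G g k ζ ∈ allowableChains R G p k) :
    ζ ∈ allowableChains R G (p.comap g) k := by
  rw [mem_allowableChains] at h ⊢
  intro σ hσ
  refine Allowable.of_comp g (h _ ?_)
  rw [Finsupp.mem_support_iff] at hσ ⊢
  rwa [chainMap, Finsupp.lmapDomain_apply, Finsupp.mapDomain_apply (comp_injective hg k)]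

theorem interChains_of_chainMap {g : C(Y, X)} (hg : Function.Injective g) {k : ℕ}
    {ζ : Chain Y G k} (h : chainMap R G g k ζ ∈ interChains R G p k) :
    ζ ∈ interChains R G (p.comap g) k := by
  cases k with
  | zero => exact allowable_of_chainMap hg h
  | succ k =>
    refine ⟨allowable_of_chainMap hg h.1, ?_⟩
    change boundary R G Y k ζ ∈ allowableChains R G (p.comap g) k
    refine allowable_of_chainMap hg ?_
    rw [← chainMap_boundary]
    exact h.2

/-- A simplex with image in `U` factors through `U`, and allowability, also of the boundary, is
reflected by the inclusion. -/
theorem exists_chainMap_eq {U : Opens X} {k : ℕ} {ξ : Chain X G k}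
    (h : ξ ∈ interChainsIn R G p U k) :
    ∃ ζ ∈ interChains R G (p.on U) k, chainMap R G (incl U) k ζ = ξ := by
  obtain ⟨h1, h2⟩ := mem_interChainsIn.1 h
  have hinj := comp_injective (incl_injective U) k
  have heq : chainMap R G (incl U) k (ξ.comapDomain _ hinj.injOn) = ξ := by
    refine Finsupp.mapDomain_comapDomain _ hinj ξ fun σ hσ => ?_
    have hσU : ∀ x, σ x ∈ U := fun x => h2 σ hσ ⟨x, rfl⟩
    exact ⟨⟨fun x => ⟨σ x, hσU x⟩, by fun_prop⟩, rfl⟩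
  refine ⟨_, interChains_of_chainMap (incl_injective U) ?_, heq⟩
  rw [heq]
  exact h1

theorem chainMap_mem_interChainsIn {U : Opens X} (hU : (F.on U).LocallyFinite) {k : ℕ}
    {ζ : Chain U G k} (h : ζ ∈ interChains R G (p.on U) k) :
    chainMap R G (incl U) k ζ ∈ interChainsIn R G p U k := by
  classical
  refine mem_interChainsIn.2
    ⟨chainMap_mem R G (incl U) (fun _ _ h => Allowable.comp (incl U) hU h) k ζ h, ?_⟩
  intro τ hτ
  obtain ⟨σ, -, rfl⟩ := Finset.mem_image.1 (Finsupp.mapDomain_support hτ)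
  rintro _ ⟨x, rfl⟩
  exact (σ x).2

/-- Every stratum of `X` that meets a subset of an open `W` contains a stratum of `W` that meets it,
so finiteness passes from `W` to `X`. -/
theorem Filtration.LocallyFinite.of_cover {U V : Opens X} (hcover : U ⊔ V = ⊤)
    (hU : (F.on U).LocallyFinite) (hV : (F.on V).LocallyFinite) : F.LocallyFinite := by
  have key : ∀ W : Opens X, (F.on W).LocallyFinite → ∀ x ∈ W,
      ∃ N ∈ 𝓝 x, {S : F.Stratum | (S.carrier ∩ N).Nonempty}.Finite := by
    intro W hW x hx
    obtain ⟨N, hN, hfin⟩ := hW ⟨x, hx⟩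
    refine ⟨Subtype.val '' N, W.isOpen.isOpenEmbedding_subtypeVal.image_mem_nhds.2 hN,
      (hfin.image (Filtration.Stratum.map F (incl W))).subset ?_⟩
    rintro S ⟨_, hyS, y, hy, rfl⟩
    obtain ⟨S', hS', rfl⟩ := Filtration.Stratum.exists_of_mem (incl W) S hyS
    exact ⟨S', ⟨y, hS', hy⟩, rfl⟩
  intro x
  have : x ∈ U ⊔ V := hcover ▸ Opens.mem_top x
  rcases this with hx | hx
  · exact key U hU x hx
  · exact key V hV x hx

theorem interComplex_d_apply (k : ℕ) (ξ : interChains R G p (k + 1)) :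
    (((interComplex R G p).d (k + 1) k).hom ξ : interChains R G p k).1 =
      boundary R G X k ξ.1 := by
  simp only [interComplex, ChainComplex.of_d]
  rfl

theorem isSingularCycle_of_mem_cycleSubmodule {k : ℕ} {z : interChains R G p k}
    (hz : z ∈ cycleSubmodule (interComplex R G p) k) : IsSingularCycle R z.1 := by
  cases k with
  | zero => trivial
  | succ k =>
    have h0 : ((interComplex R G p).d (k + 1) k).hom z = 0 := hz
    change boundary R G X k z.1 = 0
    rw [← interComplex_d_apply, h0]
    rfl

end opens

end

end PolyIH

/-! ### The Mayer-Vietoris sequence of intersection homology -/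

theorem mainTheorem2 {X : Type*} [TopologicalSpace X] [T2Space X] {n : ℕ}
    (F : PolyIH.Filtration X n) (p : PolyIH.Perversity F)
    (R : Type*) [CommRing R] [IsDedekindDomain R] (G : Type*) [AddCommGroup G] [Module R G]
    (U V : TopologicalSpace.Opens X) (hcover : U ⊔ V = ⊤)
    (hU : (F.on U).LocallyFinite) (hV : (F.on V).LocallyFinite)
    (hUV : (F.on (U ⊓ V)).LocallyFinite) :
    ∃ δ : ∀ k : ℕ, PolyIH.interHomology R G p (k + 1) →ₗ[R]
        PolyIH.interHomology R G (p.on (U ⊓ V)) k,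
      (∀ k : ℕ, Function.Exact
        ((PolyIH.inclLEHomology R G p (inf_le_left : U ⊓ V ≤ U) hUV k).prod
          (-PolyIH.inclLEHomology R G p (inf_le_right : U ⊓ V ≤ V) hUV k))
        ((PolyIH.inclHomology R G p U hU k).coprod (PolyIH.inclHomology R G p V hV k))) ∧
      (∀ k : ℕ, Function.Exact
        ((PolyIH.inclHomology R G p U hU (k + 1)).coprod
          (PolyIH.inclHomology R G p V hV (k + 1)))
        (δ k)) ∧
      (∀ k : ℕ, Function.Exact
        (δ k)
        ((PolyIH.inclLEHomology R G p (inf_le_left : U ⊓ V ≤ U) hUV k).prod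
          (-PolyIH.inclLEHomology R G p (inf_le_right : U ⊓ V ≤ V) hUV k))) ∧
      Function.Surjective
        ((PolyIH.inclHomology R G p U hU 0).coprod (PolyIH.inclHomology R G p V hV 0)) := by
  have hF := PolyIH.Filtration.LocallyFinite.of_cover hcover hU hV
  have hsmall : ∀ k, ∀ ζ ∈ PolyIH.smallChains R G p U V k,
      ∃ b ∈ PolyIH.interChains R G (p.on U) k, ∃ c ∈ PolyIH.interChains R G (p.on V) k,
        ζ = PolyIH.chainMap R G (PolyIH.incl U) k b + PolyIH.chainMap R G (PolyIH.incl V) k c := by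
    intro k ζ hζ
    obtain ⟨y, hy, z, hz, rfl⟩ := Submodule.mem_sup.1 hζ
    obtain ⟨b, hb, rfl⟩ := PolyIH.exists_chainMap_eq hy
    obtain ⟨c, hc, rfl⟩ := PolyIH.exists_chainMap_eq hz
    exact ⟨b, hb, c, hc, rfl⟩
  refine PolyIH.exact_mayerVietoris
    (PolyIH.interMap R G (PolyIH.inclLE (inf_le_left : U ⊓ V ≤ U)) _)
    (PolyIH.interMap R G (PolyIH.inclLE (inf_le_right : U ⊓ V ≤ V)) _)
    (PolyIH.interMap R G (PolyIH.incl U) _) (PolyIH.interMap R G (PolyIH.incl V) _)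
    ?_ ?_ ?_ ?_ ?_ ?_
  · intro k a a' h
    exact Subtype.ext (PolyIH.chainMap_injective (R := R) (PolyIH.inclLE_injective _) k
      (congrArg Subtype.val h))
  · intro k a a' h
    exact Subtype.ext (PolyIH.chainMap_injective (R := R) (PolyIH.incl_injective V) k
      (congrArg Subtype.val h))
  · intro k a
    exact Subtype.ext ((PolyIH.chainMap_inclLE (R := R) _ k a.1).trans
      (PolyIH.chainMap_inclLE (R := R) _ k a.1).symm)
  · intro k b c h
    have h' : PolyIH.chainMap R G (PolyIH.incl U) k b.1 =
      PolyIH.chainMap R G (PolyIH.incl V) k c.1 := congrArg Subtype.val h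
    have hbU := PolyIH.mem_interChainsIn.1 (PolyIH.chainMap_mem_interChainsIn hU b.2)
    have hcV := PolyIH.mem_interChainsIn.1 (PolyIH.chainMap_mem_interChainsIn hV c.2)
    -- The two images are the same chain of `X`, so each of its simplexes lies in `U` and in `V`.
    obtain ⟨a, ha, hab⟩ := PolyIH.exists_chainMap_eq (U := U ⊓ V)
      (PolyIH.mem_interChainsIn.2 ⟨hbU.1, fun σ hσ =>
        Set.subset_inter (hbU.2 σ hσ) (hcV.2 σ (h' ▸ hσ))⟩)
    refine ⟨⟨a, ha⟩, Subtype.ext (PolyIH.chainMap_injective (R := R) (PolyIH.incl_injective U) k ?_)⟩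
    exact (PolyIH.chainMap_inclLE (R := R) _ k a).trans hab
  · intro k z hz
    obtain ⟨ζ, hζ, η, hη, h⟩ := PolyIH.exists_small_cycle hF hcover z.2
      (PolyIH.isSingularCycle_of_mem_cycleSubmodule hz)
    obtain ⟨b, hb, c, hc, rfl⟩ := hsmall k ζ hζ
    refine ⟨⟨b, hb⟩, ⟨c, hc⟩, ⟨η, hη⟩, Subtype.ext (h.trans ?_)⟩
    exact congrArg _ (PolyIH.interComplex_d_apply (p := p) k ⟨η, hη⟩).symm
  · intro k z b c h
    have hd := PolyIH.interComplex_d_apply (p := p) k z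
    have h' : PolyIH.boundary R G X k z.1 = PolyIH.chainMap R G (PolyIH.incl U) k b.1 +
      PolyIH.chainMap R G (PolyIH.incl V) k c.1 := hd.symm.trans (congrArg Subtype.val h)
    obtain ⟨ζ, hζ, hzζ⟩ := PolyIH.exists_small_bounding (U := U) (V := V) hF hcover z.2 (by
      rw [h']
      exact Submodule.add_mem_sup (PolyIH.chainMap_mem_interChainsIn hU b.2)
        (PolyIH.chainMap_mem_interChainsIn hV c.2))
    obtain ⟨b', hb', c', hc', rfl⟩ := hsmall (k + 1) ζ hζ
    refine ⟨⟨b', hb'⟩, ⟨c', hc'⟩, Subtype.ext (hd.trans (hzζ.trans ?_))⟩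
    rw [map_add, PolyIH.chainMap_boundary, PolyIH.chainMap_boundary]
    exact congrArg₂ (fun x y => PolyIH.chainMap R G (PolyIH.incl U) k x +
        PolyIH.chainMap R G (PolyIH.incl V) k y)
      (PolyIH.interComplex_d_apply (p := p.on U) k ⟨b', hb'⟩).symm
      (PolyIH.interComplex_d_apply (p := p.on V) k ⟨c', hc'⟩).symm
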